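/- For $a,b>0$ let $L(a,b)=\dfrac{b-a}{\log b-\log a}$ if $a\ne b$ and $L(a,a)=a$. A mean in three variables is a continuous function $M$ on $(0,\infty)^3$ with $\min(a,b,c)\le M(a,b,c)\le\max(a,b,c)$. It is type 1 invariant for $L$ if $M(L(a,c),L(a,b),L(b,c))=M(a,b,c)$ for all $a,b,c>0$, and type 2 invariant for $L$ if $M(a,b,L(a,b))=L(a,b)$ for all $a,b>0$. Let $L_3(a,b,c)$ be the limit of the sequence $(a_n)$, where $(a_0,b_0,c_0)=(a,b,c)$ and $a_{n+1}=L(a_n,c_n)$, $b_{n+1}=L(c_n,b_n)$, $c_{n+1}=L(a_n,b_n)$. Write $Q=(1,1,1)$. Then: 1. $L_3$ is a symmetric mean, it is type 1 invariant for $L$, and it is the only mean in three variables that is type 1 invariant for $L$. 2. $L_3$ is not type 2 invariant for $L$. 3. $L_3$ is four times continuously differentiable near $Q$, and $(L_3)_{xxxy}(Q)=\dfrac{136}{2025}$. 4. If a symmetric mean $M$ were both type 1 and type 2 invariant for $L$, it would satisfy $M_{xxxy}(Q)=\dfrac{248}{3645}$. More precisely (and without contradictory hypotheses), every symmetric homogeneous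 mean $M$ in three variables that is four times continuously differentiable near $Q$, is type 2 invariant for $L$, and satisfies $M_{xxx}(Q)=(L_3)_{xxx}(Q)$ has $M_{xxxy}(Q)=\dfrac{248}{3645}$. -/

import Mathlib

open Filter Topology

noncomputable section

/-- The logarithmic mean `L(a,b) = (b - a) / (log b - log a)`, with its continuous
extension `L(a,a) = a` on the diagonal. -/
def logMean (a b : ℝ) : ℝ :=
  if a = b then a else (b - a) / (Real.log b - Real.log a)

/-- The open positive octant. -/
def posOctant : Set (ℝ × ℝ × ℝ) := {p | 0 < p.1 ∧ 0 < p.2.1 ∧ 0 < p.2.2}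

/-- A function of three variables, as a function on triples. -/
def onTriples (M : ℝ → ℝ → ℝ → ℝ) : ℝ × ℝ × ℝ → ℝ := fun p => M p.1 p.2.1 p.2.2

/-- Means in three variables: continuous on the positive octant and lying between the
minimum and the maximum of the arguments. -/
def IsMean3 (M : ℝ → ℝ → ℝ → ℝ) : Prop :=
  ContinuousOn (onTriples M) posOctant ∧
    ∀ a b c : ℝ, 0 < a → 0 < b → 0 < c →
      min a (min b c) ≤ M a b c ∧ M a b c ≤ max a (max b c)

/-- Symmetry on the positive octant (the two transpositions generate all permutations). -/
def IsSymmetric3 (M : ℝ → ℝ → ℝ → ℝ) : Prop :=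
  ∀ a b c : ℝ, 0 < a → 0 < b → 0 < c → M b a c = M a b c ∧ M a c b = M a b c

/-- Homogeneity (of degree one) on the positive octant. -/
def IsHomogeneous3 (M : ℝ → ℝ → ℝ → ℝ) : Prop :=
  ∀ k a b c : ℝ, 0 < k → 0 < a → 0 < b → 0 < c → M (k * a) (k * b) (k * c) = k * M a b c

/-- `M` is type 1 invariant with respect to `m`. -/
def Type1Invariant (M : ℝ → ℝ → ℝ → ℝ) (m : ℝ → ℝ → ℝ) : Prop :=
  ∀ a b c : ℝ, 0 < a → 0 < b → 0 < c → M (m a c) (m a b) (m b c) = M a b c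

/-- `M` is type 2 invariant with respect to `m`. -/
def Type2Invariant (M : ℝ → ℝ → ℝ → ℝ) (m : ℝ → ℝ → ℝ) : Prop :=
  ∀ a b : ℝ, 0 < a → 0 < b → M a b (m a b) = m a b

/-- The triples `(a_n, b_n, c_n)` with `a_{n+1} = m(a_n, c_n)`, `b_{n+1} = m(c_n, b_n)`,
`c_{n+1} = m(a_n, b_n)`, started at `(a, b, c)`. -/
def meanIter (m : ℝ → ℝ → ℝ) (a b c : ℝ) : ℕ → ℝ × ℝ × ℝ
  | 0 => (a, b, c)
  | n + 1 =>
    let p := meanIter m a b c n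
    (m p.1 p.2.2, m p.2.2 p.2.1, m p.1 p.2.1)

/-- The invariant logarithmic mean `L₃`: the limit of the iteration of the logarithmic
mean. -/
def logMean3 (a b c : ℝ) : ℝ :=
  limUnder atTop (fun n => (meanIter logMean a b c n).1)

/-- The partial derivative `M_xxx(1,1,1)`. -/
def partialXXX (M : ℝ → ℝ → ℝ → ℝ) : ℝ :=
  iteratedDeriv 3 (fun x => M x 1 1) 1

/-- The partial derivative `M_xxxy(1,1,1)`. -/
def partialXXXY (M : ℝ → ℝ → ℝ → ℝ) : ℝ :=
  deriv (fun y => iteratedDeriv 3 (fun x => M x y 1) 1) 1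

end

/-! ### The logarithmic mean -/

/-! Existence and uniqueness of the limit rest on trapping. On a compact range of positive numbers
`logMean` stays a fixed proportion away from distinct arguments (`exists_logMean_bounds`), so every
step shrinks an interval containing the triple by a fixed factor (`exists_coordsIn_contract`). Hence
`logMean3 a b c` is the only number lying in every positive interval that contains an iterate.
Symmetry, continuity and uniqueness among type 1 invariant means follow from this.

Smoothness at the diagonal comes from complex analysis. The iteration extends holomorphically near
`(1, 1, 1)`, and the derivative of `logMeanC` at `(1, 1)` is the arithmetic mean, so the steps decay
geometrically on a complex ball. The limit is a telescoping series of holomorphic maps, and Cauchy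
estimates make its sum `C^4` (`contDiffOn_tsum_of_norm_le_on_ball`).

The mixed derivative is then algebra with fourth-order expansions. Euler's relation and symmetry
reduce it to the third and fourth derivatives of `x ↦ M x 1 1` (`partialXXXY_eq`). Type 1 invariance
determines both (`coeffs_of_type1Invariant`). Type 2 invariance determines the fourth from the third
(`coeff_of_type2Invariant`). The resulting values `136 / 2025` and `248 / 3645` differ, so
`logMean3` is not type 2 invariant. -/

theorem logMean_comm (a b : ℝ) : logMean a b = logMean b a := by
  unfold logMean
  by_cases h : a = b
  · simp [h]
  · rw [if_neg h, if_neg (Ne.symm h), ← neg_sub a b, ← neg_sub (Real.log a), neg_div_neg_eq]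

theorem logMean_self (a : ℝ) : logMean a a = a := by simp [logMean]

theorem logMean_mul {k a b : ℝ} (hk : 0 < k) (ha : 0 < a) (hb : 0 < b) :
    logMean (k * a) (k * b) = k * logMean a b := by
  unfold logMean
  by_cases h : a = b
  · simp [h]
  · have : k * a ≠ k * b := fun h' => h (mul_left_cancel₀ hk.ne' h')
    rw [if_neg h, if_neg this, Real.log_mul hk.ne' ha.ne', Real.log_mul hk.ne' hb.ne']
    rw [add_sub_add_left_eq_sub, ← mul_sub, mul_div_assoc]

/-- With `u = log b - log a` the mean is `a * (exp u - 1) / u`. The removable singularity is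
absorbed by `dslope`, so continuity, the complex extension and the expansions need no case split on
the diagonal. -/
theorem logMean_eq_mul_dslope {a b : ℝ} (ha : 0 < a) (hb : 0 < b) :
    logMean a b = a * dslope Real.exp 0 (Real.log b - Real.log a) := by
  unfold logMean
  by_cases h : a = b
  · simp [h]
  · have hne : Real.log b - Real.log a ≠ 0 := by
      rw [sub_ne_zero]
      exact fun h' => h (Real.log_injOn_pos hb ha h').symm
    rw [if_neg h, dslope_of_ne _ hne, slope_def_field, Real.exp_sub, Real.exp_log ha,
      Real.exp_log hb, Real.exp_zero, sub_zero]
    field_simp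

theorem continuous_dslope_exp : Continuous (dslope Real.exp 0) := by
  rw [← continuousOn_univ, continuousOn_dslope univ_mem]
  exact ⟨Real.continuous_exp.continuousOn, Real.differentiableAt_exp⟩

theorem ContinuousAt.logMean {X : Type*} [TopologicalSpace X] {f g : X → ℝ} {x : X}
    (hf : ContinuousAt f x) (hg : ContinuousAt g x) (hfx : 0 < f x) (hgx : 0 < g x) :
    ContinuousAt (fun y => logMean (f y) (g y)) x := by
  have h : (fun y => f y * dslope Real.exp 0 (Real.log (g y) - Real.log (f y))) =ᶠ[𝓝 x]
      fun y => _root_.logMean (f y) (g y) := by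
    filter_upwards [hf.eventually (lt_mem_nhds hfx), hg.eventually (lt_mem_nhds hgx)] with y h1 h2
    exact (logMean_eq_mul_dslope h1 h2).symm
  refine ContinuousAt.congr ?_ h
  exact hf.mul (continuous_dslope_exp.continuousAt.comp
    ((hg.log hgx.ne').sub (hf.log hfx.ne')))

/-- The inequality `log x ≤ x - 1` at `r / s` and at `s / r` bounds `log r - log s` between `(r - s)
/ r` and `(r - s) / s`. Squared arguments make the bounds strictly interior: the arithmetic mean of
`s` and `r` appears as a factor. -/
theorem logMean_sq_bounds {s r : ℝ} (hs : 0 < s) (hsr : s ≤ r) :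
    s * (s + r) / 2 ≤ logMean (s ^ 2) (r ^ 2) ∧ logMean (s ^ 2) (r ^ 2) ≤ r * (s + r) / 2 := by
  have hr : 0 < r := hs.trans_le hsr
  rcases hsr.eq_or_lt with rfl | hlt
  · rw [logMean_self]; constructor <;> nlinarith
  have hne : s ^ 2 ≠ r ^ 2 := by
    have : s ^ 2 < r ^ 2 := by gcongr
    exact this.ne
  have hlog : 0 < Real.log r - Real.log s := sub_pos.2 (Real.log_lt_log hs hlt)
  have h1 : Real.log r - Real.log s ≤ r / s - 1 := by
    rw [← Real.log_div hr.ne' hs.ne']; exact Real.log_le_sub_one_of_pos (by positivity)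
  have h2 : Real.log s - Real.log r ≤ s / r - 1 := by
    rw [← Real.log_div hs.ne' hr.ne']; exact Real.log_le_sub_one_of_pos (by positivity)
  have h1' : s * (Real.log r - Real.log s) ≤ r - s := by
    calc s * (Real.log r - Real.log s) ≤ s * (r / s - 1) := by gcongr
      _ = r - s := by field_simp
  have h2' : r - s ≤ r * (Real.log r - Real.log s) := by
    have : r * (Real.log s - Real.log r) ≤ r * (s / r - 1) := by gcongr
    have e : r * (s / r - 1) = s - r := by field_simp
    nlinarith
  rw [logMean, if_neg hne, Real.log_pow, Real.log_pow]
  push_cast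
  rw [← mul_sub]
  constructor
  · rw [le_div_iff₀ (by positivity)]
    nlinarith [mul_le_mul_of_nonneg_left h1' (by positivity : 0 ≤ s + r)]
  · rw [div_le_iff₀ (by positivity)]
    nlinarith [mul_le_mul_of_nonneg_left h2' (by positivity : 0 ≤ s + r)]

/-- On a compact interval of positive numbers, the logarithmic mean stays uniformly away from
its arguments. -/
theorem exists_logMean_bounds {m Z : ℝ} (hm : 0 < m) (hmZ : m ≤ Z) :
    ∃ κ : ℝ, 0 < κ ∧ κ < 1 ∧ ∀ a b : ℝ, m ≤ a → a ≤ b → b ≤ Z →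
      a + κ * (b - a) ≤ logMean a b ∧ logMean a b ≤ b - κ * (b - a) := by
  have hZ : 0 < Z := hm.trans_le hmZ
  have hsZ : 0 < √Z := Real.sqrt_pos.2 hZ
  have hsm : 0 < √m := Real.sqrt_pos.2 hm
  have hmZ' : √m ≤ √Z := Real.sqrt_le_sqrt hmZ
  have hκ4 : √m / (4 * √Z) ≤ 1 / 4 := by
    rw [div_le_div_iff₀ (by positivity) (by positivity)]; linarith
  -- The lower estimate needs `κ * (s + r) ≤ s / 2`, where `s ≥ √m` and `s + r ≤ 2 * √Z`; the upper
  -- one needs only `κ ≤ 1 / 4`.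
  refine ⟨√m / (4 * √Z), by positivity, by linarith, fun a b hma hab hbZ => ?_⟩
  have ha : 0 < a := hm.trans_le hma
  have hb : 0 < b := ha.trans_le hab
  have hsa : 0 < √a := Real.sqrt_pos.2 ha
  have hsab : √a ≤ √b := Real.sqrt_le_sqrt hab
  obtain ⟨h1, h2⟩ := logMean_sq_bounds hsa hsab
  rw [Real.sq_sqrt ha.le, Real.sq_sqrt hb.le] at h1 h2
  have ea : a = √a ^ 2 := (Real.sq_sqrt ha.le).symm
  have eb : b = √b ^ 2 := (Real.sq_sqrt hb.le).symm
  have hma' : √m ≤ √a := Real.sqrt_le_sqrt hma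
  have hbZ' : √b ≤ √Z := Real.sqrt_le_sqrt hbZ
  set κ := √m / (4 * √Z) with hκ
  have hκm : κ * (4 * √Z) = √m := by rw [hκ]; field_simp
  have hκ0 : 0 < κ := by positivity
  set s := √a
  set r := √b
  rw [ea, eb]
  constructor
  · have h3 : κ * (s + r) ≤ s / 2 := by nlinarith
    rw [ea, eb] at h1
    nlinarith [mul_le_mul_of_nonneg_right h3 (sub_nonneg.2 hsab)]
  · rw [ea, eb] at h2
    have h3 : κ * (r ^ 2 - s ^ 2) ≤ 1 / 4 * (r ^ 2 - s ^ 2) := by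
      apply mul_le_mul_of_nonneg_right hκ4; nlinarith
    nlinarith [sq_nonneg (r - s)]

theorem logMean_mem_Icc {a b x z : ℝ} (hx : 0 < x) (ha : a ∈ Set.Icc x z) (hb : b ∈ Set.Icc x z) :
    logMean a b ∈ Set.Icc x z := by
  wlog hab : a ≤ b generalizing a b
  · rw [logMean_comm]; exact this hb ha (le_of_not_ge hab)
  obtain ⟨κ, h0, _, h⟩ := exists_logMean_bounds hx (ha.1.trans ha.2)
  obtain ⟨h1, h2⟩ := h a b ha.1 hab hb.2
  have : 0 ≤ κ * (b - a) := mul_nonneg h0.le (sub_nonneg.2 hab)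
  exact ⟨by linarith [ha.1], by linarith [hb.2]⟩

theorem logMean_pos {a b : ℝ} (ha : 0 < a) (hb : 0 < b) : 0 < logMean a b :=
  (lt_min ha hb).trans_le
    (logMean_mem_Icc (z := max a b) (lt_min ha hb) ⟨min_le_left _ _, le_max_left _ _⟩
      ⟨min_le_right _ _, le_max_right _ _⟩).1

/-! ### The iteration -/

/-- All three coordinates lie in `[x, z]`. -/
def CoordsIn (x z : ℝ) (p : ℝ × ℝ × ℝ) : Prop :=
  p.1 ∈ Set.Icc x z ∧ p.2.1 ∈ Set.Icc x z ∧ p.2.2 ∈ Set.Icc x z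

theorem meanIter_succ' (m : ℝ → ℝ → ℝ) (a b c : ℝ) (n : ℕ) :
    meanIter m a b c (n + 1) = meanIter m (m a c) (m c b) (m a b) n := by
  induction n with
  | zero => rfl
  | succ n ih => rw [meanIter, ih]; rfl

/-- Permuting the starting triple permutes the triple after one step, though not by the same
permutation. `CoordsIn` ignores the order of coordinates, so the induction need not track which
permutation arises. -/
theorem coordsIn_meanIter_perm {m : ℝ → ℝ → ℝ} (hm : ∀ a b, m a b = m b a) (x z : ℝ) (n : ℕ)
    (a b c : ℝ) :
    (CoordsIn x z (meanIter m b a c n) ↔ CoordsIn x z (meanIter m a b c n)) ∧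
    (CoordsIn x z (meanIter m a c b n) ↔ CoordsIn x z (meanIter m a b c n)) := by
  induction n generalizing a b c with
  | zero => simp only [meanIter, CoordsIn]; tauto
  | succ n ih =>
    simp only [meanIter_succ']
    constructor
    · rw [hm b c, hm c a, hm b a, (ih (m a c) (m c b) (m a b)).1]
    · rw [hm b c, (ih (m a b) (m a c) (m c b)).2, (ih _ _ _).1, (ih _ _ _).2]

theorem coordsIn_meanIter_succ {x z a b c : ℝ} (hx : 0 < x) {n : ℕ}
    (h : CoordsIn x z (meanIter logMean a b c n)) :
    CoordsIn x z (meanIter logMean a b c (n + 1)) :=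
  ⟨logMean_mem_Icc hx h.1 h.2.2, logMean_mem_Icc hx h.2.2 h.2.1, logMean_mem_Icc hx h.1 h.2.1⟩

theorem coordsIn_meanIter_add {x z a b c : ℝ} (hx : 0 < x) {n : ℕ}
    (h : CoordsIn x z (meanIter logMean a b c n)) (k : ℕ) :
    CoordsIn x z (meanIter logMean a b c (n + k)) := by
  induction k with
  | zero => exact h
  | succ k ih => exact coordsIn_meanIter_succ hx ih

theorem meanIter_logMean_pos {a b c : ℝ} (ha : 0 < a) (hb : 0 < b) (hc : 0 < c) (n : ℕ) :
    meanIter logMean a b c n ∈ posOctant := by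
  induction n with
  | zero => exact ⟨ha, hb, hc⟩
  | succ n ih =>
    exact ⟨logMean_pos ih.1 ih.2.2, logMean_pos ih.2.2 ih.2.1, logMean_pos ih.1 ih.2.1⟩

/-- Two of three numbers lie in the same half of an interval, and this contracts the interval. -/
theorem exists_coordsIn_contract {m Z : ℝ} (hm : 0 < m) (hmZ : m ≤ Z) :
    ∃ q : ℝ, 0 ≤ q ∧ q < 1 ∧ ∀ x z a b c : ℝ, m ≤ x → z ≤ Z → CoordsIn x z (a, b, c) →
      ∃ x' z', x ≤ x' ∧ z' ≤ z ∧ z' - x' ≤ q * (z - x) ∧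
        CoordsIn x' z' (logMean a c, logMean c b, logMean a b) := by
  obtain ⟨κ, h0, h1, hκ⟩ := exists_logMean_bounds hm hmZ
  refine ⟨1 - κ / 2, by linarith, by linarith, fun x z a b c hx hz h => ?_⟩
  have hx0 : 0 < x := hm.trans_le hx
  have low : ∀ s t, s ∈ Set.Icc x z → t ∈ Set.Icc x z → (s ≤ (x + z) / 2 ∨ t ≤ (x + z) / 2) →
      logMean s t ∈ Set.Icc x (z - κ / 2 * (z - x)) := by
    intro s t hs ht hst
    refine ⟨(logMean_mem_Icc hx0 hs ht).1, ?_⟩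
    wlog hle : s ≤ t generalizing s t
    · rw [logMean_comm]; exact this t s ht hs hst.symm (le_of_not_ge hle)
    have hs2 : s ≤ (x + z) / 2 := hst.elim id hle.trans
    have := (hκ s t (hx.trans hs.1) hle (ht.2.trans hz)).2
    nlinarith [ht.2]
  have high : ∀ s t, s ∈ Set.Icc x z → t ∈ Set.Icc x z → ((x + z) / 2 ≤ s ∨ (x + z) / 2 ≤ t) →
      logMean s t ∈ Set.Icc (x + κ / 2 * (z - x)) z := by
    intro s t hs ht hst
    refine ⟨?_, (logMean_mem_Icc hx0 hs ht).2⟩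
    wlog hle : s ≤ t generalizing s t
    · rw [logMean_comm]; exact this t s ht hs hst.symm (le_of_not_ge hle)
    have ht2 : (x + z) / 2 ≤ t := hst.elim (fun h => h.trans hle) id
    have := (hκ s t (hx.trans hs.1) hle (ht.2.trans hz)).1
    nlinarith [hs.1]
  obtain ⟨ha, hb, hc⟩ := h
  simp only at ha hb hc
  have hxz : x ≤ z := ha.1.trans ha.2
  -- Either every pair meets the lower half, or some pair lies wholly in the upper half. In the
  -- second case each of the three pairs shares an element with that pair.
  by_cases hlow : (a ≤ (x + z) / 2 ∨ c ≤ (x + z) / 2) ∧ (c ≤ (x + z) / 2 ∨ b ≤ (x + z) / 2) ∧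
      (a ≤ (x + z) / 2 ∨ b ≤ (x + z) / 2)
  · refine ⟨x, z - κ / 2 * (z - x), le_rfl, ?_, by linarith, low a c ha hc hlow.1,
      low c b hc hb hlow.2.1, low a b ha hb hlow.2.2⟩
    nlinarith
  · refine ⟨x + κ / 2 * (z - x), z, ?_, le_rfl, by linarith, high a c ha hc ?_,
      high c b hc hb ?_, high a b ha hb ?_⟩
    · nlinarith
    all_goals
      by_contra hcon
      push Not at hcon
      exact hlow (by
        rcases hcon with ⟨h1, h2⟩
        simp only [h1.le, h2.le, true_or, or_true, and_self])

theorem exists_coordsIn_meanIter_pow {a b c : ℝ} (ha : 0 < a) (hb : 0 < b) (hc : 0 < c) :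
    ∃ m Z q : ℝ, 0 < m ∧ 0 ≤ q ∧ q < 1 ∧ ∀ n, ∃ x z, m ≤ x ∧ z ≤ Z ∧ z - x ≤ q ^ n * (Z - m) ∧
      CoordsIn x z (meanIter logMean a b c n) := by
  have hm : 0 < min a (min b c) := lt_min ha (lt_min hb hc)
  have hmZ : min a (min b c) ≤ max a (max b c) := (min_le_left _ _).trans (le_max_left _ _)
  -- One factor `q` serves for all `n`, because the trapping intervals never leave the range of the
  -- starting triple.
  obtain ⟨q, hq0, hq1, hq⟩ := exists_coordsIn_contract hm hmZ
  refine ⟨_, max a (max b c), q, hm, hq0, hq1, fun n => ?_⟩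
  induction n with
  | zero =>
    refine ⟨_, _, le_rfl, le_rfl, by simp, ?_, ?_, ?_⟩ <;> simp [meanIter]
  | succ n ih =>
    obtain ⟨x, z, hx, hz, hxz, h⟩ := ih
    obtain ⟨x', z', hx', hz', hxz', h'⟩ := hq x z _ _ _ hx hz h
    refine ⟨x', z', hx.trans hx', hz'.trans hz, ?_, h'⟩
    calc z' - x' ≤ q * (z - x) := hxz'
      _ ≤ q * (q ^ n * (max a (max b c) - min a (min b c))) := by gcongr
      _ = _ := by ring

theorem exists_coordsIn_meanIter_lt {a b c : ℝ} (ha : 0 < a) (hb : 0 < b) (hc : 0 < c) {ε : ℝ}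
    (hε : 0 < ε) :
    ∃ n x z, 0 < x ∧ z - x < ε ∧ CoordsIn x z (meanIter logMean a b c n) := by
  obtain ⟨m, Z, q, hm, hq0, hq1, h⟩ := exists_coordsIn_meanIter_pow ha hb hc
  have ht : Tendsto (fun n : ℕ => q ^ n * (Z - m)) atTop (𝓝 0) := by
    simpa using (tendsto_pow_atTop_nhds_zero_of_lt_one hq0 hq1).mul_const (Z - m)
  obtain ⟨n, hn⟩ := (ht.eventually (gt_mem_nhds hε)).exists
  obtain ⟨x, z, hx, _, hxz, hin⟩ := h n
  exact ⟨n, x, z, hm.trans_le hx, hxz.trans_lt hn, hin⟩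

/-! ### The limit: symmetry, invariance, continuity and uniqueness -/

theorem tendsto_meanIter_logMean3 {a b c : ℝ} (ha : 0 < a) (hb : 0 < b) (hc : 0 < c) :
    Tendsto (fun n => (meanIter logMean a b c n).1) atTop (𝓝 (logMean3 a b c)) := by
  have hC : CauchySeq (fun n => (meanIter logMean a b c n).1) := by
    rw [Metric.cauchySeq_iff']
    intro ε hε
    obtain ⟨n, x, z, hx, hxz, h⟩ := exists_coordsIn_meanIter_lt ha hb hc hε
    refine ⟨n, fun k hk => ?_⟩
    obtain ⟨j, rfl⟩ := Nat.exists_eq_add_of_le hk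
    have h' := coordsIn_meanIter_add hx h j
    exact (Real.dist_le_of_mem_Icc h'.1 h.1).trans_lt hxz
  exact tendsto_nhds_limUnder (cauchySeq_tendsto_of_complete hC)

theorem logMean3_mem_Icc {a b c : ℝ} (ha : 0 < a) (hb : 0 < b) (hc : 0 < c) {n : ℕ} {x z : ℝ}
    (hx : 0 < x) (h : CoordsIn x z (meanIter logMean a b c n)) :
    logMean3 a b c ∈ Set.Icc x z := by
  refine isClosed_Icc.mem_of_tendsto (tendsto_meanIter_logMean3 ha hb hc) ?_
  filter_upwards [eventually_ge_atTop n] with k hk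
  obtain ⟨j, rfl⟩ := Nat.exists_eq_add_of_le hk
  exact (coordsIn_meanIter_add hx h j).1

/-- A number is `logMean3 a b c` as soon as it lies in every interval that contains all
coordinates of some iterate. -/
theorem eq_logMean3_of_mem_Icc {a b c : ℝ} (ha : 0 < a) (hb : 0 < b) (hc : 0 < c) {u : ℝ}
    (hu : ∀ n x z, 0 < x → CoordsIn x z (meanIter logMean a b c n) → u ∈ Set.Icc x z) :
    u = logMean3 a b c := by
  refine eq_of_forall_dist_le fun ε hε => ?_
  obtain ⟨n, x, z, hx, hxz, h⟩ := exists_coordsIn_meanIter_lt ha hb hc hε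
  exact (Real.dist_le_of_mem_Icc (hu n x z hx h) (logMean3_mem_Icc ha hb hc hx h)).trans hxz.le

theorem isSymmetric3_logMean3 : IsSymmetric3 logMean3 := fun a b c ha hb hc =>
  ⟨eq_logMean3_of_mem_Icc ha hb hc fun n x z hx h => logMean3_mem_Icc hb ha hc hx
      ((coordsIn_meanIter_perm logMean_comm x z n a b c).1.2 h),
    eq_logMean3_of_mem_Icc ha hb hc fun n x z hx h => logMean3_mem_Icc ha hc hb hx
      ((coordsIn_meanIter_perm logMean_comm x z n a b c).2.2 h)⟩

theorem logMean3_step {a b c : ℝ} (ha : 0 < a) (hb : 0 < b) (hc : 0 < c) :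
    logMean3 (logMean a c) (logMean c b) (logMean a b) = logMean3 a b c := by
  have h := tendsto_meanIter_logMean3 (logMean_pos ha hc) (logMean_pos hc hb) (logMean_pos ha hb)
  simp only [← meanIter_succ'] at h
  exact tendsto_nhds_unique h ((tendsto_add_atTop_iff_nat 1).2 (tendsto_meanIter_logMean3 ha hb hc))

theorem type1Invariant_logMean3 : Type1Invariant logMean3 logMean := fun a b c ha hb hc => by
  rw [(isSymmetric3_logMean3 _ _ _ (logMean_pos ha hc) (logMean_pos hb hc) (logMean_pos ha hb)).2,
    logMean_comm b c, logMean3_step ha hb hc]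

theorem isHomogeneous3_logMean3 : IsHomogeneous3 logMean3 := by
  intro k a b c hk ha hb hc
  have h : ∀ n, meanIter logMean (k * a) (k * b) (k * c) n =
      (k * (meanIter logMean a b c n).1, k * (meanIter logMean a b c n).2.1,
        k * (meanIter logMean a b c n).2.2) := by
    intro n
    induction n with
    | zero => rfl
    | succ n ih =>
      have hp := meanIter_logMean_pos ha hb hc n
      simp only [meanIter, ih, logMean_mul hk hp.1 hp.2.2, logMean_mul hk hp.2.2 hp.2.1,
        logMean_mul hk hp.1 hp.2.1]
  have h1 := tendsto_meanIter_logMean3 (mul_pos hk ha) (mul_pos hk hb) (mul_pos hk hc)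
  simp only [h] at h1
  exact tendsto_nhds_unique h1 ((tendsto_meanIter_logMean3 ha hb hc).const_mul k)

theorem continuousAt_meanIter_logMean (n : ℕ) {p : ℝ × ℝ × ℝ} (hp : p ∈ posOctant) :
    ContinuousAt (fun q : ℝ × ℝ × ℝ => meanIter logMean q.1 q.2.1 q.2.2 n) p := by
  induction n with
  | zero => exact continuousAt_id
  | succ n ih =>
    have h := meanIter_logMean_pos hp.1 hp.2.1 hp.2.2 n
    have h1 := ih.fst
    have h2 := ih.snd.fst
    have h3 := ih.snd.snd
    exact (h1.logMean h3 h.1 h.2.2).prodMk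
      ((h3.logMean h2 h.2.2 h.2.1).prodMk (h1.logMean h2 h.1 h.2.1))

theorem isOpen_posOctant : IsOpen posOctant :=
  (isOpen_lt continuous_const continuous_fst).inter
    ((isOpen_lt continuous_const continuous_snd.fst).inter
      (isOpen_lt continuous_const continuous_snd.snd))

/-- A fixed iterate depends continuously on the starting triple and already confines the limit to a
short interval; nearby triples have their limits in a slightly larger one. -/
theorem continuousAt_logMean3 {p : ℝ × ℝ × ℝ} (hp : p ∈ posOctant) :
    ContinuousAt (onTriples logMean3) p := by
  rw [Metric.continuousAt_iff']
  intro ε hε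
  obtain ⟨n, x, z, hx, hxz, h⟩ :=
    exists_coordsIn_meanIter_lt hp.1 hp.2.1 hp.2.2 (half_pos hε)
  -- The bound `x / 2` keeps the enlarged interval positive, and `ε / 4` keeps its length below `ε`.
  set δ := min (x / 2) (ε / 4)
  have hδ : 0 < δ := lt_min (half_pos hx) (by positivity)
  have hδx : δ ≤ x / 2 := min_le_left _ _
  have hδε : δ ≤ ε / 4 := min_le_right _ _
  have hc := continuousAt_meanIter_logMean n hp
  have hI : ∀ y ∈ Set.Icc x z, Set.Icc (x - δ) (z + δ) ∈ 𝓝 y := fun y hy =>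
    Icc_mem_nhds (by linarith [hy.1]) (by linarith [hy.2])
  filter_upwards [isOpen_posOctant.mem_nhds hp, hc.fst (hI _ h.1), hc.snd.fst (hI _ h.2.1),
    hc.snd.snd (hI _ h.2.2)] with q hq h1 h2 h3
  have hq' := logMean3_mem_Icc hq.1 hq.2.1 hq.2.2 (by linarith) (⟨h1, h2, h3⟩ : CoordsIn _ _ _)
  have hp' := logMean3_mem_Icc hp.1 hp.2.1 hp.2.2 hx h
  have hp'' : logMean3 p.1 p.2.1 p.2.2 ∈ Set.Icc (x - δ) (z + δ) :=
    ⟨by linarith [hp'.1], by linarith [hp'.2]⟩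
  exact (Real.dist_le_of_mem_Icc hq' hp'').trans_lt (by linarith)

theorem isMean3_logMean3 : IsMean3 logMean3 := by
  refine ⟨fun p hp => (continuousAt_logMean3 hp).continuousWithinAt, fun a b c ha hb hc => ?_⟩
  refine logMean3_mem_Icc (n := 0) ha hb hc (lt_min ha (lt_min hb hc)) ⟨?_, ?_, ?_⟩ <;>
    simp [meanIter]

/-- Invariance keeps the value of `M` constant along the iteration, and the mean property places
that value in every interval containing an iterate. -/
theorem eq_logMean3_of_type1Invariant {M : ℝ → ℝ → ℝ → ℝ} (hM : IsMean3 M)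
    (h1 : Type1Invariant M logMean) {a b c : ℝ} (ha : 0 < a) (hb : 0 < b) (hc : 0 < c) :
    M a b c = logMean3 a b c := by
  refine eq_logMean3_of_mem_Icc ha hb hc fun n x z hx h => ?_
  induction n generalizing a b c with
  | zero =>
    obtain ⟨h2, h3⟩ := hM.2 a b c ha hb hc
    exact ⟨(le_min h.1.1 (le_min h.2.1.1 h.2.2.1)).trans h2,
      h3.trans (max_le h.1.2 (max_le h.2.1.2 h.2.2.2))⟩
  | succ n ih =>
    rw [← h1 a b c ha hb hc]
    refine ih (logMean_pos ha hc) (logMean_pos ha hb) (logMean_pos hb hc) ?_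
    rw [meanIter_succ'] at h
    rw [logMean_comm b c]
    exact (coordsIn_meanIter_perm logMean_comm x z n _ _ _).2.2 h

/-! ### Series of complex differentiable maps -/

/-- A series of smooth maps between complex normed spaces, bounded on a ball by a summable
sequence, has a `C^k` sum on a smaller ball. -/
theorem contDiffOn_tsum_of_norm_le_on_ball {E : Type} [NormedAddCommGroup E] [NormedSpace ℂ E]
    {x₀ : E} (k : ℕ) {F : Type} [NormedAddCommGroup F] [NormedSpace ℂ F] [CompleteSpace F]
    {h : ℕ → E → F} {u : ℕ → ℝ} {r : ℝ} (hr : 0 < r) (hu : Summable u)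
    (hh : ∀ n, ContDiffOn ℂ ⊤ (h n) (Metric.ball x₀ r))
    (hb : ∀ n, ∀ x ∈ Metric.ball x₀ r, ‖h n x‖ ≤ u n) :
    ContDiffOn ℂ k (fun x => ∑' n, h n x) (Metric.ball x₀ (r / 2 ^ k)) := by
  -- The target space must vary: the induction hypothesis is applied to the series of derivatives,
  -- with values in `E →L[ℂ] F`, on the ball of half the radius.
  induction k generalizing F r u with
  | zero =>
    simp only [pow_zero, div_one, CharP.cast_eq_zero, contDiffOn_zero]
    exact continuousOn_tsum (fun n => (hh n).continuousOn) hu hb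
  | succ k ih =>
    have hr2 : 0 < r / 2 := half_pos hr
    have hsub : Metric.ball x₀ (r / 2) ⊆ Metric.ball x₀ r := Metric.ball_subset_ball (by linarith)
    have hd : ∀ n, DifferentiableOn ℂ (h n) (Metric.ball x₀ r) := fun n =>
      (hh n).differentiableOn (by simp)
    have hf' : ∀ n, ∀ x ∈ Metric.ball x₀ (r / 2), ‖fderiv ℂ (h n) x‖ ≤ 4 / r * u n := by
      intro n x hx
      have hxr : Metric.ball x (r / 2) ⊆ Metric.ball x₀ r := by
        refine Metric.ball_subset_ball' ?_
        have := Metric.mem_ball.1 hx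
        linarith
      -- Cauchy estimate: `h n` moves by at most `2 * u n` on a ball of radius `r / 2`, which gives
      -- the factor `4 / r`.
      have := Complex.norm_fderiv_le_div_of_mapsTo_ball ((hd n).mono hxr) (R₂ := 2 * u n) ?_ hr2
      · refine this.trans_eq ?_
        field_simp
        ring
      · intro y hy
        rw [mem_closedBall_iff_norm]
        have h1 := hb n y (hxr hy)
        have h2 := hb n x (hsub hx)
        linarith [norm_sub_le (h n y) (h n x)]
    have hfd : ∀ x ∈ Metric.ball x₀ (r / 2),
        HasFDerivAt (fun x => ∑' n, h n x) (∑' n, fderiv ℂ (h n) x) x := by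
      intro x hx
      refine hasFDerivAt_tsum_of_isPreconnected (hu.mul_left (4 / r)) Metric.isOpen_ball
        (convex_ball x₀ (r / 2)).isPreconnected (fun n y hy => ?_) hf' hx ?_ hx
      · exact ((hd n).differentiableAt (Metric.isOpen_ball.mem_nhds (hsub hy))).hasFDerivAt
      · exact Summable.of_norm_bounded hu fun n => hb n x (hsub hx)
    have hle : r / 2 ^ (k + 1) ≤ r / 2 := by
      rw [pow_succ']
      gcongr
      have : (1 : ℝ) ≤ 2 ^ k := one_le_pow₀ (by norm_num)
      linarith
    have hsub2 := Metric.ball_subset_ball (x := x₀) hle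
    have hkey := ih hr2 (hu.mul_left (4 / r)) (h := fun n => fderiv ℂ (h n))
      (fun n => ((hh n).fderiv_of_isOpen Metric.isOpen_ball (by simp)).mono hsub) hf'
    rw [div_div, ← pow_succ'] at hkey
    push_cast
    rw [contDiffOn_succ_iff_fderiv_of_isOpen Metric.isOpen_ball]
    refine ⟨fun x hx => (hfd x (hsub2 hx)).differentiableAt.differentiableWithinAt, by simp, ?_⟩
    exact hkey.congr fun x hx => (hfd x (hsub2 hx)).fderiv

/-! ### The complex logarithmic mean near `(1, 1)` -/

/-- The logarithmic mean of complex numbers, with its holomorphic extension to the diagonal. -/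
noncomputable def logMeanC (a b : ℂ) : ℂ :=
  a * dslope Complex.exp 0 (Complex.log b - Complex.log a)

theorem logMeanC_self (a : ℂ) : logMeanC a a = a := by simp [logMeanC]

theorem logMeanC_ofReal {a b : ℝ} (ha : 0 < a) (hb : 0 < b) :
    logMeanC a b = (logMean a b : ℝ) := by
  rw [logMean_eq_mul_dslope ha hb, logMeanC, ← Complex.ofReal_log ha.le, ← Complex.ofReal_log hb.le,
    ← Complex.ofReal_sub]
  by_cases h : Real.log b - Real.log a = 0
  · simp [h]
  · rw [dslope_of_ne _ h, dslope_of_ne _ (by exact_mod_cast h), slope_def_field, slope_def_field]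
    push_cast
    simp

theorem differentiable_dslope_cexp : Differentiable ℂ (dslope Complex.exp 0) := by
  rw [← differentiableOn_univ, Complex.differentiableOn_dslope univ_mem]
  exact Complex.differentiable_exp.differentiableOn

theorem dslope_cexp_neg (z : ℂ) :
    dslope Complex.exp 0 z = Complex.exp z * dslope Complex.exp 0 (-z) := by
  by_cases h : z = 0
  · simp [h]
  · rw [dslope_of_ne _ h, dslope_of_ne _ (neg_ne_zero.2 h), slope_def_field, slope_def_field,
      Complex.exp_neg]
    have h1 := Complex.exp_ne_zero z
    rw [Complex.exp_zero, sub_zero, sub_zero, div_neg, mul_neg, ← mul_div_assoc, ← neg_div]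
    congr 1
    rw [mul_sub, mul_inv_cancel₀ h1]
    ring

/-- Write `φ` for the slope function. Differentiating `φ z = exp z * φ (-z)` at `0` gives `d = 1 -
d`. -/
theorem hasDerivAt_dslope_cexp_zero : HasDerivAt (dslope Complex.exp 0) (1 / 2) 0 := by
  obtain ⟨d, hd⟩ : ∃ d, HasDerivAt (dslope Complex.exp 0) d 0 :=
    ⟨_, differentiable_dslope_cexp.differentiableAt.hasDerivAt⟩
  have h1 : HasDerivAt (fun z => dslope Complex.exp 0 (-z)) (d * -1) 0 := by
    have : HasDerivAt (dslope Complex.exp 0) d (-0) := by simpa using hd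
    exact this.comp (0 : ℂ) (hasDerivAt_neg (0 : ℂ))
  have h2 := (Complex.hasDerivAt_exp 0).mul h1
  have h3 : (Complex.exp * fun z => dslope Complex.exp 0 (-z)) = dslope Complex.exp 0 :=
    funext fun z => (dslope_cexp_neg z).symm
  rw [h3] at h2
  have h4 := hd.unique h2
  simp only [Complex.exp_zero, neg_zero, dslope_same, Complex.deriv_exp] at h4
  have h5 : d = 1 / 2 := by linear_combination h4 / 2
  exact h5 ▸ hd

theorem contDiffAt_logMeanC {p : ℂ × ℂ} (h1 : p.1 ∈ Complex.slitPlane)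
    (h2 : p.2 ∈ Complex.slitPlane) {n : WithTop ℕ∞} :
    ContDiffAt ℂ n (fun q : ℂ × ℂ => logMeanC q.1 q.2) p := by
  have h3 : ContDiffAt ℂ n (fun q : ℂ × ℂ => Complex.log q.2 - Complex.log q.1) p :=
    ((Complex.contDiffAt_log h2).comp p contDiffAt_snd).sub
      ((Complex.contDiffAt_log h1).comp p contDiffAt_fst)
  exact contDiffAt_fst.mul ((differentiable_dslope_cexp.contDiff.contDiffAt).comp p h3)

theorem ContDiffAt.logMeanC {E : Type*} [NormedAddCommGroup E] [NormedSpace ℂ E] {f g : E → ℂ}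
    {x : E} {n : WithTop ℕ∞} (hf : ContDiffAt ℂ n f x) (hg : ContDiffAt ℂ n g x)
    (hfx : f x ∈ Complex.slitPlane) (hgx : g x ∈ Complex.slitPlane) :
    ContDiffAt ℂ n (fun y => _root_.logMeanC (f y) (g y)) x :=
  ContDiffAt.comp (g := fun q : ℂ × ℂ => _root_.logMeanC q.1 q.2) x
    (contDiffAt_logMeanC (p := (f x, g x)) hfx hgx) (hf.prodMk hg)

theorem fderiv_logMeanC_one (v : ℂ × ℂ) :
    fderiv ℂ (fun q : ℂ × ℂ => logMeanC q.1 q.2) (1, 1) v = (v.1 + v.2) / 2 := by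
  have h1 : HasFDerivAt (fun q : ℂ × ℂ => q.1) (ContinuousLinearMap.fst ℂ ℂ ℂ) (1, 1) :=
    hasFDerivAt_fst
  have h2 : HasFDerivAt (fun q : ℂ × ℂ => q.2) (ContinuousLinearMap.snd ℂ ℂ ℂ) (1, 1) :=
    hasFDerivAt_snd
  have h3 := (h2.clog (by simp)).sub (h1.clog (by simp))
  have hd : HasDerivAt (dslope Complex.exp 0) (1 / 2)
      ((fun q : ℂ × ℂ => Complex.log q.2 - Complex.log q.1) (1, 1)) := by
    simpa using hasDerivAt_dslope_cexp_zero
  have h4 := h1.mul (hd.comp_hasFDerivAt (1, 1) h3)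
  have h5 := h4.fderiv
  change fderiv ℂ (fun q : ℂ × ℂ => logMeanC q.1 q.2) (1, 1) = _ at h5
  rw [h5]
  simp
  ring

/-- Near `(1, 1)` the complex logarithmic mean is close to the arithmetic mean. -/
theorem exists_logMeanC_approx :
    ∃ δ : ℝ, 0 < δ ∧ δ ≤ 1 ∧ ∀ a b c d : ℂ, a ∈ Metric.ball 1 δ → b ∈ Metric.ball 1 δ →
      c ∈ Metric.ball 1 δ → d ∈ Metric.ball 1 δ →
      ‖logMeanC a b - logMeanC c d - ((a - c) + (b - d)) / 2‖ ≤ 1 / 4 * max ‖a - c‖ ‖b - d‖ := by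
  -- Strict differentiability is needed, since the estimate compares two arbitrary nearby points
  -- rather than one point with `(1, 1)`.
  have hs := (contDiffAt_logMeanC (n := 1) (p := (1, 1)) (by simp) (by simp)).hasStrictFDerivAt
    one_ne_zero
  have h := hs.isLittleO.def (c := 1 / 4) (by norm_num)
  rw [nhds_prod_eq, Filter.eventually_iff, ← nhds_prod_eq, Metric.mem_nhds_iff] at h
  obtain ⟨δ, hδ, hsub⟩ := h
  refine ⟨min δ 1, lt_min hδ one_pos, min_le_right _ _, fun a b c d ha hb hc hd => ?_⟩
  have hm : (((a, b), (c, d)) : (ℂ × ℂ) × (ℂ × ℂ)) ∈ Metric.ball (((1, 1), (1, 1)) : (ℂ × ℂ) × (ℂ × ℂ)) δ := by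
    have h' := fun x (hx : x ∈ Metric.ball (1 : ℂ) (min δ 1)) =>
      (Metric.mem_ball.1 hx).trans_le (min_le_left _ _)
    simp only [Metric.mem_ball, Prod.dist_eq, max_lt_iff]
    exact ⟨⟨h' a ha, h' b hb⟩, h' c hc, h' d hd⟩
  have := hsub hm
  simpa [fderiv_logMeanC_one, Prod.norm_def] using this

/-! ### The complex iteration near `(1, 1, 1)` -/

/-- The complex version of `meanIter logMean`. -/
noncomputable def meanIterC : ℕ → ℂ × ℂ × ℂ → ℂ × ℂ × ℂ
  | 0 => fun p => p
  | n + 1 => fun p =>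
    (logMeanC (meanIterC n p).1 (meanIterC n p).2.2,
      logMeanC (meanIterC n p).2.2 (meanIterC n p).2.1,
      logMeanC (meanIterC n p).1 (meanIterC n p).2.1)

theorem meanIterC_ofReal {a b c : ℝ} (ha : 0 < a) (hb : 0 < b) (hc : 0 < c) (n : ℕ) :
    meanIterC n (a, b, c) = (((meanIter logMean a b c n).1 : ℂ),
      ((meanIter logMean a b c n).2.1 : ℂ), ((meanIter logMean a b c n).2.2 : ℂ)) := by
  induction n with
  | zero => rfl
  | succ n ih =>
    have h := meanIter_logMean_pos ha hb hc n
    simp only [meanIterC, meanIter, ih, logMeanC_ofReal h.1 h.2.2, logMeanC_ofReal h.2.2 h.2.1,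
      logMeanC_ofReal h.1 h.2.1]

/-- Near `(1, 1, 1)` the complex iteration stays in the domain of holomorphy and its steps decay
geometrically. -/
theorem exists_meanIterC_bounds :
    ∃ δ : ℝ, 0 < δ ∧ δ ≤ 1 ∧ ∀ p ∈ Metric.ball ((1, 1, 1) : ℂ × ℂ × ℂ) (δ / 8), ∀ n,
      ((meanIterC n p).1 ∈ Metric.ball 1 δ ∧ (meanIterC n p).2.1 ∈ Metric.ball 1 δ ∧
        (meanIterC n p).2.2 ∈ Metric.ball 1 δ) ∧
      ‖(meanIterC (n + 1) p).1 - (meanIterC n p).1‖ ≤ 3 / 16 * δ * (3 / 4) ^ n := by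
  obtain ⟨δ, hδ, hδ1, happ⟩ := exists_logMeanC_approx
  -- The linear part contributes `D / 2` and the error `D / 4`. Bounding the sum of the increments
  -- by `D` rather than `2 * D` is what gives a contraction; in the iteration that sum is again a
  -- difference of two coordinates.
  have hL : ∀ a b c d : ℂ, a ∈ Metric.ball 1 δ → b ∈ Metric.ball 1 δ →
      c ∈ Metric.ball 1 δ → d ∈ Metric.ball 1 δ → ∀ D : ℝ, ‖a - c‖ ≤ D → ‖b - d‖ ≤ D →
      ‖(a - c) + (b - d)‖ ≤ D → ‖logMeanC a b - logMeanC c d‖ ≤ 3 / 4 * D := by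
    intro a b c d ha hb hc hd D h1 h2 h3
    have h4 := (happ a b c d ha hb hc hd).trans
      (mul_le_mul_of_nonneg_left (max_le h1 h2) (by norm_num))
    have h5 : ‖((a - c) + (b - d)) / 2‖ ≤ D / 2 := by
      rw [norm_div, Complex.norm_two]; gcongr
    have h6 := norm_add_le (logMeanC a b - logMeanC c d - ((a - c) + (b - d)) / 2)
      (((a - c) + (b - d)) / 2)
    rw [sub_add_cancel] at h6
    linarith
  refine ⟨δ, hδ, hδ1, fun p hp => ?_⟩
  rw [mem_ball_iff_norm, Prod.norm_def, Prod.norm_def, max_lt_iff, max_lt_iff] at hp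
  obtain ⟨hp1, hp2, hp3⟩ := hp
  simp only [Prod.fst_sub, Prod.snd_sub] at hp1 hp2 hp3
  have tri : ∀ x y : ℂ, ‖x - 1‖ < δ / 8 → ‖y - 1‖ < δ / 8 → ‖x - y‖ ≤ δ / 4 := by
    intro x y hx hy
    have := norm_sub_le (x - 1) (y - 1)
    rw [sub_sub_sub_cancel_right] at this
    linarith
  -- The steps sum to at most `3 / 4 * δ`; with the initial `δ / 8` the first coordinate stays
  -- within `7 / 8 * δ` of `1`. The partial-sum form leaves room for the other two coordinates.
  have key : ∀ n, ‖(meanIterC n p).1 - 1‖ ≤ δ / 8 + 3 / 4 * δ * (1 - (3 / 4) ^ n) ∧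
      ‖(meanIterC n p).1 - (meanIterC n p).2.1‖ ≤ δ / 4 * (3 / 4) ^ n ∧
      ‖(meanIterC n p).2.1 - (meanIterC n p).2.2‖ ≤ δ / 4 * (3 / 4) ^ n ∧
      ‖(meanIterC n p).1 - (meanIterC n p).2.2‖ ≤ δ / 4 * (3 / 4) ^ n →
      (((meanIterC n p).1 ∈ Metric.ball 1 δ ∧ (meanIterC n p).2.1 ∈ Metric.ball 1 δ ∧
        (meanIterC n p).2.2 ∈ Metric.ball 1 δ) ∧
      ‖(meanIterC (n + 1) p).1 - (meanIterC n p).1‖ ≤ 3 / 16 * δ * (3 / 4) ^ n) := by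
    rintro n ⟨h1, h2, -, h4⟩
    have hq : (0 : ℝ) < (3 / 4) ^ n := by positivity
    have hq1 : (0 : ℝ) < δ * (3 / 4) ^ n := by positivity
    have hb1 : (meanIterC n p).1 ∈ Metric.ball 1 δ := by
      rw [mem_ball_iff_norm]; nlinarith
    have aux : ∀ x : ℂ, ‖(meanIterC n p).1 - x‖ ≤ δ / 4 * (3 / 4) ^ n → x ∈ Metric.ball 1 δ := by
      intro x hx
      rw [mem_ball_iff_norm]
      have := norm_sub_le ((meanIterC n p).1 - 1) ((meanIterC n p).1 - x)
      rw [sub_sub_sub_cancel_left] at this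
      nlinarith
    refine ⟨⟨hb1, aux _ h2, aux _ h4⟩, ?_⟩
    -- A step compares `logMeanC a c` with `a = logMeanC a a`.
    have := hL _ _ _ _ hb1 (aux _ h4) hb1 hb1 (δ / 4 * (3 / 4) ^ n)
      (by rw [sub_self, norm_zero]; positivity) (by rwa [norm_sub_rev])
      (by rwa [sub_self, zero_add, norm_sub_rev])
    rw [logMeanC_self] at this
    refine this.trans_eq (by ring)
  suffices hinv : ∀ n, _ from fun n => key n (hinv n)
  intro n
  induction n with
  | zero =>
    simp only [meanIterC, pow_zero, sub_self, mul_zero, add_zero, mul_one]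
    exact ⟨hp1.le, tri _ _ hp1 hp2, tri _ _ hp2 hp3, tri _ _ hp1 hp3⟩
  | succ n ih =>
    obtain ⟨⟨ha, hb, hc⟩, hstep⟩ := key n ih
    obtain ⟨h1, h2, h3, h4⟩ := ih
    have e : δ / 4 * (3 / 4) ^ (n + 1) = 3 / 4 * (δ / 4 * (3 / 4) ^ n) := by ring
    rw [e]
    refine ⟨?_, ?_, ?_, ?_⟩
    · have := norm_add_le ((meanIterC (n + 1) p).1 - (meanIterC n p).1) ((meanIterC n p).1 - 1)
      rw [sub_add_sub_cancel] at this
      rw [pow_succ]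
      linarith
    · exact hL _ _ _ _ ha hc hc hb _ h4 (by rwa [norm_sub_rev]) (by rwa [sub_add_sub_cancel])
    · exact hL _ _ _ _ hc hb ha hb _ (by rwa [norm_sub_rev])
        (by rw [sub_self, norm_zero]; positivity)
        (by rwa [sub_self, add_zero, norm_sub_rev])
    · exact hL _ _ _ _ ha hc ha hb _ (by rw [sub_self, norm_zero]; positivity)
        (by rwa [norm_sub_rev]) (by rwa [sub_self, zero_add, norm_sub_rev])

/-- On real triples the limit is the real part of the first coordinate plus the telescoping series
of complex steps, which the geometric bound makes `C^4`. -/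
theorem contDiffAt_onTriples_logMean3 : ContDiffAt ℝ 4 (onTriples logMean3) (1, 1, 1) := by
  obtain ⟨δ, hδ, hδ1, hbd⟩ := exists_meanIterC_bounds
  have hslit : ∀ x : ℂ, x ∈ Metric.ball 1 δ → x ∈ Complex.slitPlane := fun x hx =>
    Complex.ball_one_subset_slitPlane (Metric.ball_subset_ball hδ1 hx)
  have hsm : ∀ n, ContDiffOn ℂ ⊤ (meanIterC n) (Metric.ball (1, 1, 1) (δ / 8)) := by
    intro n p hp
    refine ContDiffAt.contDiffWithinAt ?_
    induction n with
    | zero => exact contDiffAt_id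
    | succ n ih =>
      obtain ⟨⟨h1, h2, h3⟩, -⟩ := hbd p hp n
      have c1 := ih.fst
      have c2 := ih.snd.fst
      have c3 := ih.snd.snd
      exact (c1.logMeanC c3 (hslit _ h1) (hslit _ h3)).prodMk
        ((c3.logMeanC c2 (hslit _ h3) (hslit _ h2)).prodMk
          (c1.logMeanC c2 (hslit _ h1) (hslit _ h2)))
  have hu : Summable fun n : ℕ => 3 / 16 * δ * (3 / 4 : ℝ) ^ n :=
    (summable_geometric_of_lt_one (by norm_num) (by norm_num)).mul_left _
  have hsum := contDiffOn_tsum_of_norm_le_on_ball (x₀ := ((1, 1, 1) : ℂ × ℂ × ℂ)) 4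
    (h := fun n p => (meanIterC (n + 1) p).1 - (meanIterC n p).1) (by positivity : 0 < δ / 8) hu
    (fun n => (hsm (n + 1)).fst.sub (hsm n).fst) (fun n p hp => (hbd p hp n).2)
  have hF : ContDiffAt ℂ 4 (fun p : ℂ × ℂ × ℂ =>
      p.1 + ∑' n, ((meanIterC (n + 1) p).1 - (meanIterC n p).1)) (1, 1, 1) :=
    contDiffAt_fst.add (hsum.contDiffAt (Metric.ball_mem_nhds _ (by positivity)))
  have hι : ContDiffAt ℝ 4 (fun p : ℝ × ℝ × ℝ => ((p.1 : ℂ), (p.2.1 : ℂ), (p.2.2 : ℂ)))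
      (1, 1, 1) :=
    ((Complex.ofRealCLM.contDiff.comp contDiff_fst).prodMk
      ((Complex.ofRealCLM.contDiff.comp contDiff_snd.fst).prodMk
        (Complex.ofRealCLM.contDiff.comp contDiff_snd.snd))).contDiffAt
  have hF' := hF.restrict_scalars ℝ
  have hre : ContDiffAt ℝ 4 (fun p : ℝ × ℝ × ℝ => ((p.1 : ℂ) + ∑' n,
      ((meanIterC (n + 1) (p.1, p.2.1, p.2.2)).1 - (meanIterC n (p.1, p.2.1, p.2.2)).1)).re)
      (1, 1, 1) :=
    Complex.reCLM.contDiff.contDiffAt.comp ((1, 1, 1) : ℝ × ℝ × ℝ)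
      (ContDiffAt.comp (g := fun p : ℂ × ℂ × ℂ =>
        p.1 + ∑' n, ((meanIterC (n + 1) p).1 - (meanIterC n p).1)) ((1, 1, 1) : ℝ × ℝ × ℝ)
        (by simpa only [Complex.ofReal_one] using hF') hι)
  refine hre.congr_of_eventuallyEq ?_
  filter_upwards [hι.continuousAt.preimage_mem_nhds (Metric.ball_mem_nhds _ (by positivity :
    0 < δ / 8)), isOpen_posOctant.mem_nhds (show ((1, 1, 1) : ℝ × ℝ × ℝ) ∈ posOctant from
      ⟨one_pos, one_pos, one_pos⟩)] with p hp hpos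
  have hp' : ((p.1 : ℂ), (p.2.1 : ℂ), (p.2.2 : ℂ)) ∈
      Metric.ball ((1, 1, 1) : ℂ × ℂ × ℂ) (δ / 8) := by simpa using hp
  have hs : Summable fun n => (meanIterC (n + 1) ((p.1 : ℂ), (p.2.1 : ℂ), (p.2.2 : ℂ))).1 -
      (meanIterC n ((p.1 : ℂ), (p.2.1 : ℂ), (p.2.2 : ℂ))).1 :=
    Summable.of_norm_bounded hu fun n => (hbd _ hp' n).2
  have h1 := hs.hasSum.tendsto_sum_nat
  have h2 := (Complex.continuous_ofReal.tendsto _).comp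
    (tendsto_meanIter_logMean3 hpos.1 hpos.2.1 hpos.2.2)
  have h3 := tendsto_nhds_unique (f := fun N => (meanIterC N ((p.1 : ℂ), (p.2.1 : ℂ), (p.2.2 : ℂ))).1)
    (by simp only [meanIterC_ofReal hpos.1 hpos.2.1 hpos.2.2]; exact h2)
    (by
      have := h1.const_add (p.1 : ℂ)
      simp only [Finset.sum_range_sub (fun n =>
        (meanIterC n ((p.1 : ℂ), (p.2.1 : ℂ), (p.2.2 : ℂ))).1)] at this
      simpa [meanIterC] using this)
  have h4 := congrArg Complex.re h3
  rwa [Complex.ofReal_re] at h4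

/-! ### Fourth-order expansions at `0` -/

/-- `f t = a₀ + a₁ t + a₂ t² + a₃ t³ + a₄ t⁴ + o(t⁴)` as `t → 0`. -/
def HasJet (f : ℝ → ℝ) (a₀ a₁ a₂ a₃ a₄ : ℝ) : Prop :=
  (fun t => f t - (a₀ + a₁ * t + a₂ * t ^ 2 + a₃ * t ^ 3 + a₄ * t ^ 4)) =o[𝓝 0] fun t => t ^ 4

theorem isLittleO_pow_five_mul {R : ℝ → ℝ} (hR : Continuous R) :
    (fun t => t ^ 5 * R t) =o[𝓝 0] fun t : ℝ => t ^ 4 := by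
  have h1 : (fun t : ℝ => t * R t) =o[𝓝 0] fun _ : ℝ => (1 : ℝ) := by
    rw [Asymptotics.isLittleO_one_iff]
    have : Continuous fun t : ℝ => t * R t := by fun_prop
    simpa using this.tendsto 0
  have h2 := (Asymptotics.isBigO_refl (fun t : ℝ => t ^ 4) (𝓝 0)).mul_isLittleO h1
  refine h2.congr (fun t => by ring) (fun t => by ring)

theorem tendsto_zero_of_isLittleO_pow {f : ℝ → ℝ} (n : ℕ) {l : Filter ℝ} (hl : l ≤ 𝓝 0)
    (h : f =o[l] fun t : ℝ => t ^ n) : Tendsto f l (𝓝 0) := by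
  rw [← Asymptotics.isLittleO_one_iff ℝ]
  refine h.trans_isBigO ?_
  have : Tendsto (fun t : ℝ => t ^ n) l (𝓝 (0 ^ n)) := ((continuous_pow n).tendsto 0).mono_left hl
  exact this.isBigO_one ℝ

namespace HasJet

variable {f g : ℝ → ℝ} {a₀ a₁ a₂ a₃ a₄ b₀ b₁ b₂ b₃ b₄ : ℝ}

theorem congr_fun (h : HasJet f a₀ a₁ a₂ a₃ a₄) (hfg : f =ᶠ[𝓝 0] g) :
    HasJet g a₀ a₁ a₂ a₃ a₄ := by
  refine Asymptotics.IsLittleO.congr' h ?_ EventuallyEq.rfl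
  filter_upwards [hfg] with t ht
  rw [ht]

theorem congr_coeff (h : HasJet f a₀ a₁ a₂ a₃ a₄) (h0 : a₀ = b₀) (h1 : a₁ = b₁) (h2 : a₂ = b₂)
    (h3 : a₃ = b₃) (h4 : a₄ = b₄) : HasJet f b₀ b₁ b₂ b₃ b₄ := by
  subst h0 h1 h2 h3 h4; exact h

theorem const (c : ℝ) : HasJet (fun _ => c) c 0 0 0 0 := by
  simp [HasJet]

theorem poly (a₀ a₁ a₂ a₃ a₄ : ℝ) :
    HasJet (fun t => a₀ + a₁ * t + a₂ * t ^ 2 + a₃ * t ^ 3 + a₄ * t ^ 4) a₀ a₁ a₂ a₃ a₄ := by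
  simp [HasJet]

theorem add (hf : HasJet f a₀ a₁ a₂ a₃ a₄) (hg : HasJet g b₀ b₁ b₂ b₃ b₄) :
    HasJet (fun t => f t + g t) (a₀ + b₀) (a₁ + b₁) (a₂ + b₂) (a₃ + b₃) (a₄ + b₄) :=
  (Asymptotics.IsLittleO.add hf hg).congr_left fun t => by ring

theorem of_sub (h : (fun t => f t - g t) =o[𝓝 0] fun t : ℝ => t ^ 4)
    (hg : HasJet g a₀ a₁ a₂ a₃ a₄) : HasJet f a₀ a₁ a₂ a₃ a₄ :=
  (h.add hg).congr_left fun t => by ring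

theorem tendsto (hf : HasJet f a₀ a₁ a₂ a₃ a₄) : Tendsto f (𝓝 0) (𝓝 a₀) := by
  have h1 := tendsto_zero_of_isLittleO_pow 4 le_rfl hf
  have h2 : Continuous fun t : ℝ => a₀ + a₁ * t + a₂ * t ^ 2 + a₃ * t ^ 3 + a₄ * t ^ 4 := by
    fun_prop
  have h3 := h1.add (h2.tendsto 0)
  simpa using h3

theorem mul (hf : HasJet f a₀ a₁ a₂ a₃ a₄) (hg : HasJet g b₀ b₁ b₂ b₃ b₄) :
    HasJet (fun t => f t * g t) (a₀ * b₀) (a₀ * b₁ + a₁ * b₀) (a₀ * b₂ + a₁ * b₁ + a₂ * b₀)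
      (a₀ * b₃ + a₁ * b₂ + a₂ * b₁ + a₃ * b₀)
      (a₀ * b₄ + a₁ * b₃ + a₂ * b₂ + a₃ * b₁ + a₄ * b₀) := by
  have h1 := Asymptotics.IsLittleO.mul_isBigO hf (hg.tendsto.isBigO_one ℝ)
  have h2 : Continuous fun t : ℝ => a₀ + a₁ * t + a₂ * t ^ 2 + a₃ * t ^ 3 + a₄ * t ^ 4 := by
    fun_prop
  have h3 := ((h2.tendsto 0).isBigO_one ℝ).mul_isLittleO hg
  have h4 : Continuous fun t : ℝ => (a₁ * b₄ + a₂ * b₃ + a₃ * b₂ + a₄ * b₁) +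
    (a₂ * b₄ + a₃ * b₃ + a₄ * b₂) * t + (a₃ * b₄ + a₄ * b₃) * t ^ 2 + a₄ * b₄ * t ^ 3 := by
    fun_prop
  simp only [mul_one, one_mul] at h1 h3
  refine ((h1.add h3).add (isLittleO_pow_five_mul h4)).congr_left fun t => by ring

theorem const_mul (c : ℝ) (hf : HasJet f a₀ a₁ a₂ a₃ a₄) :
    HasJet (fun t => c * f t) (c * a₀) (c * a₁) (c * a₂) (c * a₃) (c * a₄) :=
  ((const c).mul hf).congr_coeff (by ring) (by ring) (by ring) (by ring) (by ring)

theorem sub_one (hf : HasJet f 1 a₁ a₂ a₃ a₄) : HasJet (fun t => f t - 1) 0 a₁ a₂ a₃ a₄ :=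
  Asymptotics.IsLittleO.congr_left hf fun t => by ring

/-- The hypotheses say that the `b`s are the coefficients of the reciprocal power series modulo `t ^
5`. -/
theorem inv (hf : HasJet f a₀ a₁ a₂ a₃ a₄) (h0 : a₀ * b₀ = 1) (h1 : a₀ * b₁ + a₁ * b₀ = 0)
    (h2 : a₀ * b₂ + a₁ * b₁ + a₂ * b₀ = 0) (h3 : a₀ * b₃ + a₁ * b₂ + a₂ * b₁ + a₃ * b₀ = 0)
    (h4 : a₀ * b₄ + a₁ * b₃ + a₂ * b₂ + a₃ * b₁ + a₄ * b₀ = 0) :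
    HasJet (fun t => (f t)⁻¹) b₀ b₁ b₂ b₃ b₄ := by
  have ha : a₀ ≠ 0 := left_ne_zero_of_mul_eq_one h0
  have hm := hf.mul (poly b₀ b₁ b₂ b₃ b₄)
  rw [h0, h1, h2, h3, h4] at hm
  have hi := ((hf.tendsto.inv₀ ha).isBigO_one ℝ).mul_isLittleO hm
  simp only [one_mul] at hi
  refine hi.neg_left.congr' ?_ EventuallyEq.rfl
  filter_upwards [hf.tendsto.eventually_ne ha] with t ht
  field_simp
  ring

theorem eq_zero_of_isLittleO {R : ℝ → ℝ} (hR : Continuous R) {c : ℝ} (n : ℕ)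
    (h : (fun t => c + t * R t) =o[𝓝[≠] 0] fun t : ℝ => t ^ n) : c = 0 := by
  have h1 := tendsto_zero_of_isLittleO_pow n nhdsWithin_le_nhds h
  have h2 : Continuous fun t : ℝ => c + t * R t := by fun_prop
  have h3 := (h2.tendsto 0).mono_left (nhdsWithin_le_nhds (s := {0}ᶜ))
  simpa using tendsto_nhds_unique h3 h1

theorem isLittleO_pow_of_mul {R : ℝ → ℝ} (n : ℕ)
    (h : (fun t => t * R t) =o[𝓝[≠] 0] fun t : ℝ => t ^ (n + 1)) :
    R =o[𝓝[≠] 0] fun t : ℝ => t ^ n := by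
  have h1 := (Asymptotics.isBigO_refl (fun t : ℝ => t⁻¹) (𝓝[≠] 0)).mul_isLittleO h
  refine h1.congr' ?_ ?_ <;>
  · filter_upwards [self_mem_nhdsWithin] with t ht
    have : t ≠ 0 := ht
    field_simp <;> ring

/-- The coefficients are peeled off from the lowest: the limit at `0` kills the constant term, then
one divides by `t` on the punctured neighbourhood. -/
theorem unique (hf : HasJet f a₀ a₁ a₂ a₃ a₄) (hg : HasJet f b₀ b₁ b₂ b₃ b₄) :
    a₀ = b₀ ∧ a₁ = b₁ ∧ a₂ = b₂ ∧ a₃ = b₃ ∧ a₄ = b₄ := by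
  have h := (Asymptotics.IsLittleO.sub hg hf).mono (nhdsWithin_le_nhds (s := {0}ᶜ))
  have h0 : a₀ - b₀ = 0 := by
    refine eq_zero_of_isLittleO (R := fun t => (a₁ - b₁) + t * ((a₂ - b₂) + t * ((a₃ - b₃) +
      t * (a₄ - b₄)))) (by fun_prop) 4 (h.congr_left fun t => by ring)
  have h' := isLittleO_pow_of_mul (R := fun t => (a₁ - b₁) + t * ((a₂ - b₂) + t * ((a₃ - b₃) +
      t * (a₄ - b₄)))) 3 (h.congr_left fun t => by linear_combination h0)
  have h1 := eq_zero_of_isLittleO (by fun_prop) 3 h'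
  have h'' := isLittleO_pow_of_mul (R := fun t => (a₂ - b₂) + t * ((a₃ - b₃) +
      t * (a₄ - b₄))) 2 (h'.congr_left fun t => by linear_combination h1)
  have h2 := eq_zero_of_isLittleO (by fun_prop) 2 h''
  have h''' := isLittleO_pow_of_mul (R := fun t => (a₃ - b₃) +
      t * (a₄ - b₄)) 1 (h''.congr_left fun t => by linear_combination h2)
  have h3 := eq_zero_of_isLittleO (by fun_prop) 1 h'''
  have h4 := isLittleO_pow_of_mul (R := fun t => (a₄ - b₄) + t * 0) 0
    (h'''.congr_left fun t => by linear_combination h3)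
  have h5 := eq_zero_of_isLittleO (by fun_prop) 0 h4
  refine ⟨?_, ?_, ?_, ?_, ?_⟩ <;> linarith

theorem isBigO_id (hf : HasJet f 0 a₁ a₂ a₃ a₄) : f =O[𝓝 0] fun t => t := by
  have h1 : (fun t : ℝ => t ^ 4) =O[𝓝 0] fun t : ℝ => t := by
    have h : Continuous fun t : ℝ => t ^ 3 := by fun_prop
    have := ((h.tendsto 0).isBigO_one ℝ).mul (Asymptotics.isBigO_refl (fun t : ℝ => t) (𝓝 0))
    refine this.congr (fun t => by ring) (fun t => by ring)
  have h2 : (fun t : ℝ => (a₁ + a₂ * t + a₃ * t ^ 2 + a₄ * t ^ 3) * t) =O[𝓝 0]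
      fun t : ℝ => t := by
    have h : Continuous fun t : ℝ => a₁ + a₂ * t + a₃ * t ^ 2 + a₄ * t ^ 3 := by fun_prop
    have := ((h.tendsto 0).isBigO_one ℝ).mul (Asymptotics.isBigO_refl (fun t : ℝ => t) (𝓝 0))
    simpa only [one_mul] using this
  exact ((Asymptotics.IsLittleO.isBigO hf).trans h1 |>.add h2).congr_left fun t => by ring

theorem comp (hf : HasJet f a₀ a₁ a₂ a₃ a₄) (hg : HasJet g 0 b₁ b₂ b₃ b₄) :
    HasJet (fun t => f (g t)) a₀ (a₁ * b₁) (a₁ * b₂ + a₂ * b₁ ^ 2)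
      (a₁ * b₃ + 2 * a₂ * b₁ * b₂ + a₃ * b₁ ^ 3)
      (a₁ * b₄ + a₂ * (b₂ ^ 2 + 2 * b₁ * b₃) + 3 * a₃ * b₁ ^ 2 * b₂ + a₄ * b₁ ^ 4) := by
  have h1 := (Asymptotics.IsLittleO.comp_tendsto hf hg.tendsto).trans_isBigO (hg.isBigO_id.pow 4)
  have g2 := hg.mul hg
  have g3 := g2.mul hg
  have g4 := g3.mul hg
  have h2 := ((((const a₀).add (hg.const_mul a₁)).add (g2.const_mul a₂)).add
    (g3.const_mul a₃)).add (g4.const_mul a₄)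
  refine (of_sub (h1.congr_left fun t => ?_) h2).congr_coeff ?_ ?_ ?_ ?_ ?_
  · simp only [Function.comp]
    ring
  all_goals ring

end HasJet

theorem hasJet_exp : HasJet Real.exp 1 1 (1 / 2) (1 / 6) (1 / 24) := by
  have h := Real.exp_sub_sum_range_isBigO_pow 5
  have h2 := h.trans_isLittleO
    ((isLittleO_pow_five_mul continuous_const (R := fun _ => 1)).congr_left fun t => by ring)
  refine h2.congr_left fun t => ?_
  simp [Finset.sum_range_succ, Nat.factorial]
  ring

theorem hasJet_dslope_exp :
    HasJet (dslope Real.exp 0) 1 (1 / 2) (1 / 6) (1 / 24) (1 / 120) := by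
  -- One order more than for `exp`, because forming the slope divides by `t`.
  have h := (Real.exp_sub_sum_range_isBigO_pow 6).mono (nhdsWithin_le_nhds (s := {0}ᶜ))
  have h1 := (Asymptotics.isBigO_refl (fun t : ℝ => t⁻¹) (𝓝[≠] 0)).mul h
  have h2 : (fun t => dslope Real.exp 0 t - (1 + 1 / 2 * t + 1 / 6 * t ^ 2 + 1 / 24 * t ^ 3 +
      1 / 120 * t ^ 4)) =O[𝓝[≠] 0] fun t : ℝ => t ^ 5 := by
    refine h1.congr' ?_ ?_ <;> filter_upwards [self_mem_nhdsWithin] with t ht <;>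
      have ht : t ≠ 0 := ht
    · rw [dslope_of_ne _ ht, slope_def_field]
      simp [Finset.sum_range_succ, Nat.factorial]
      field_simp
      ring
    · field_simp
  have h3 := h2.trans_isLittleO (((isLittleO_pow_five_mul continuous_const
    (R := fun _ => 1)).congr_left fun t => by ring).mono nhdsWithin_le_nhds)
  rw [HasJet, ← nhdsNE_sup_pure]
  exact h3.sup (Asymptotics.isLittleO_pure.2 (by simp))

/-! ### Taylor's formula -/

theorem iteratedDeriv_line {E : Type*} [NormedAddCommGroup E] [NormedSpace ℝ E] {f : E → ℝ}
    {s : Set E} (hs : IsOpen s) {n : ℕ} (hf : ContDiffOn ℝ n f s) (x v : E) (k : ℕ) (hk : k ≤ n)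
    (t : ℝ) (ht : x + t • v ∈ s) :
    iteratedDeriv k (fun t : ℝ => f (x + t • v)) t =
      iteratedFDeriv ℝ k f (x + t • v) (fun _ => v) := by
  induction k generalizing t with
  | zero => simp
  | succ k ih =>
    have hl : HasDerivAt (fun t : ℝ => x + t • v) v t := by
      simpa using ((hasDerivAt_id t).smul_const v).const_add x
    have hev : ∀ᶠ t' in 𝓝 t, x + t' • v ∈ s := hl.continuousAt.preimage_mem_nhds (hs.mem_nhds ht)
    have heq : iteratedDeriv k (fun t : ℝ => f (x + t • v)) =ᶠ[𝓝 t]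
        fun t => iteratedFDeriv ℝ k f (x + t • v) (fun _ => v) := by
      filter_upwards [hev] with t' ht'
      exact ih (by omega) t' ht'
    rw [iteratedDeriv_succ, heq.deriv_eq]
    have hd : DifferentiableAt ℝ (iteratedFDeriv ℝ k f) (x + t • v) := by
      have := (hf.contDiffAt (hs.mem_nhds ht))
      exact this.differentiableAt_iteratedFDeriv (by exact_mod_cast (by omega : k < n))
    have h1 := hd.hasFDerivAt.comp_hasDerivAt t hl
    have h2 : HasDerivAt (fun t => iteratedFDeriv ℝ k f (x + t • v) (fun _ => v))
        ((fderiv ℝ (iteratedFDeriv ℝ k f) (x + t • v) v) (fun _ => v)) t :=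
      (ContinuousMultilinearMap.apply ℝ (fun _ : Fin k => E) ℝ (fun _ => v)).hasFDerivAt
        |>.comp_hasDerivAt t h1
    rw [h2.deriv, iteratedFDeriv_succ_apply_left]
    rfl

/-- **Taylor's theorem** with little-o remainder, in a normed space. -/
theorem taylor_isLittleO_norm {E : Type*} [NormedAddCommGroup E] [NormedSpace ℝ E] {f : E → ℝ}
    {x : E} {n : ℕ} (hf : ContDiffAt ℝ (n + 1 : ℕ) f x) :
    (fun v => f (x + v) - ∑ k ∈ Finset.range (n + 2),
      ((k.factorial : ℝ)⁻¹) * iteratedFDeriv ℝ k f x (fun _ => v)) =o[𝓝 0]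
        fun v => ‖v‖ ^ (n + 1) := by
  obtain ⟨u, hu, hfu⟩ := hf.contDiffOn le_rfl (by simp)
  obtain ⟨r, hr, hru⟩ := Metric.mem_nhds_iff.1 hu
  have hfb := hfu.mono hru
  have hcont : ContinuousAt (iteratedFDeriv ℝ (n + 1) f) x := hf.continuousAt_iteratedFDeriv le_rfl
  rw [Asymptotics.isLittleO_iff]
  intro c hc
  obtain ⟨ρ, hρ, hρc⟩ := Metric.continuousAt_iff.1 hcont c hc
  filter_upwards [Metric.ball_mem_nhds (0 : E) (lt_min hr hρ)] with v hv
  have hv' : ‖v‖ < min r ρ := by simpa using hv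
  have hmem : ∀ t ∈ Set.Icc (0 : ℝ) 1, ‖t • v‖ < min r ρ := by
    intro t ht
    rw [norm_smul, Real.norm_of_nonneg ht.1]
    exact (mul_le_of_le_one_left (norm_nonneg v) ht.2).trans_lt hv'
  have hball : ∀ t ∈ Set.Icc (0 : ℝ) 1, x + t • v ∈ Metric.ball x r := by
    intro t ht
    simpa using (hmem t ht).trans_le (min_le_left _ _)
  have hcd : ∀ t ∈ Set.Icc (0 : ℝ) 1, ContDiffAt ℝ (n + 1 : ℕ) (fun t : ℝ => f (x + t • v)) t := by
    intro t ht
    refine ContDiffAt.comp t (hfb.contDiffAt (Metric.isOpen_ball.mem_nhds (hball t ht))) ?_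
    exact (contDiff_const.add (contDiff_id.smul contDiff_const)).contDiffAt
  have hI : Set.uIcc (0 : ℝ) 1 = Set.Icc 0 1 := Set.uIcc_of_le zero_le_one
  obtain ⟨ξ, hξ, heq⟩ := taylor_mean_remainder_lagrange_iteratedDeriv (n := n)
    (f := fun t : ℝ => f (x + t • v)) (x₀ := 0) (x := 1) zero_ne_one
    (fun t ht => (hcd t (hI ▸ ht)).contDiffWithinAt)
  have hξ' : ξ ∈ Set.Icc (0 : ℝ) 1 := by
    rw [← hI]; exact Set.Ioo_subset_Icc_self hξ
  rw [taylor_within_apply, iteratedDeriv_line Metric.isOpen_ball hfb x v (n + 1) le_rfl ξ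
    (hball ξ hξ')] at heq
  have hsum : ∑ k ∈ Finset.range (n + 1), (((k.factorial : ℝ)⁻¹ * (1 - 0) ^ k) •
      iteratedDerivWithin k (fun t : ℝ => f (x + t • v)) (Set.uIcc 0 1) 0) =
      ∑ k ∈ Finset.range (n + 1), ((k.factorial : ℝ)⁻¹) * iteratedFDeriv ℝ k f x (fun _ => v) := by
    refine Finset.sum_congr rfl fun k hk => ?_
    have hkn : k ≤ n + 1 := (Finset.mem_range.1 hk).le
    rw [iteratedDerivWithin_eq_iteratedDeriv (hI ▸ uniqueDiffOn_Icc_zero_one)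
      ((hcd 0 (by simp)).of_le (by exact_mod_cast hkn)) (by simp),
      iteratedDeriv_line Metric.isOpen_ball hfb x v k hkn 0 (hball 0 (by simp))]
    simp
  rw [hsum] at heq
  simp only [one_smul, sub_zero, one_pow, mul_one] at heq
  -- Moving the top-order Taylor term into the Lagrange remainder leaves the difference of the top
  -- derivatives at `x + ξ • v` and at `x`, small by continuity.
  rw [Finset.sum_range_succ, ← sub_sub, heq, div_eq_inv_mul, ← mul_sub,
    ← sub_apply, norm_mul, norm_pow, norm_norm]
  have hfac : ‖(((n + 1).factorial : ℝ))⁻¹‖ ≤ 1 := by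
    rw [norm_inv, Real.norm_natCast]
    exact inv_le_one_of_one_le₀ (by exact_mod_cast Nat.one_le_iff_ne_zero.2 (Nat.factorial_ne_zero _))
  have hop := (iteratedFDeriv ℝ (n + 1) f (x + ξ • v) - iteratedFDeriv ℝ (n + 1) f x).le_opNorm
    (fun _ => v)
  have hdist : ‖iteratedFDeriv ℝ (n + 1) f (x + ξ • v) - iteratedFDeriv ℝ (n + 1) f x‖ ≤ c := by
    rw [← dist_eq_norm]
    refine (hρc ?_).le
    simpa using (hmem ξ hξ').trans_le (min_le_right _ _)
  simp only [Finset.prod_const, Finset.card_univ, Fintype.card_fin] at hop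
  refine (mul_le_of_le_one_left (norm_nonneg _) hfac).trans (hop.trans ?_)
  gcongr

/-- Split `(h, k)` as `(h, 0) + (0, k)`, expand by multilinearity, and group the terms by the number
of slots that receive `(h, 0)`. -/
theorem ContinuousMultilinearMap.exists_apply_prod_eq_sum {n : ℕ}
    (D : ContinuousMultilinearMap ℝ (fun _ : Fin n => ℝ × ℝ) ℝ) :
    ∃ c : ℕ → ℝ, ∀ h k : ℝ, D (fun _ => (h, k)) =
      ∑ i ∈ Finset.range (n + 1), c i * h ^ i * k ^ (n - i) := by
  classical
  refine ⟨fun i => ∑ s : Finset (Fin n) with s.card = i,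
    D (fun j => if j ∈ s then (1, 0) else (0, 1)), fun h k => ?_⟩
  have h1 : (fun _ : Fin n => ((h, k) : ℝ × ℝ)) = (fun _ => (h, 0)) + fun _ => (0, k) := by
    ext j <;> simp
  rw [h1, D.map_add_univ, ← Finset.sum_fiberwise_of_maps_to (t := Finset.range (n + 1))
    (g := Finset.card)]
  · refine Finset.sum_congr rfl fun i _ => ?_
    rw [mul_assoc, Finset.sum_mul]
    refine Finset.sum_congr rfl fun s hs => ?_
    have hsi : s.card = i := (Finset.mem_filter.1 hs).2
    have h2 : (s.piecewise (fun _ => ((h, 0) : ℝ × ℝ)) fun _ => (0, k)) =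
        fun j => (if j ∈ s then h else k) • (if j ∈ s then ((1, 0) : ℝ × ℝ) else (0, 1)) := by
      funext j
      by_cases hj : j ∈ s <;> simp [hj]
    rw [h2, D.map_smul_univ, Finset.prod_ite, Finset.prod_const, Finset.prod_const, smul_eq_mul,
      mul_comm]
    have h3 : (Finset.univ.filter fun j => j ∈ s).card = i := by simp [hsi]
    have h4 : (Finset.univ.filter fun j => j ∉ s).card = n - i := by
      have : (Finset.univ.filter fun j => j ∉ s) = sᶜ := by ext j; simp
      rw [this, Finset.card_compl, Fintype.card_fin, hsi]
    rw [h3, h4]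
  · intro s _
    rw [Finset.mem_range, Nat.lt_succ_iff]
    simpa using s.card_le_univ

theorem exists_taylor_prod {Φ : ℝ × ℝ → ℝ} {x : ℝ × ℝ} (hΦ : ContDiffAt ℝ 4 Φ x) :
    ∃ c : ℕ → ℕ → ℝ, (fun v : ℝ × ℝ => Φ (x + v) - ∑ n ∈ Finset.range 5,
      ∑ i ∈ Finset.range (n + 1), c n i * v.1 ^ i * v.2 ^ (n - i)) =o[𝓝 0] fun v => ‖v‖ ^ 4 := by
  have h := taylor_isLittleO_norm (n := 3) (f := Φ) (x := x) (by exact_mod_cast hΦ)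
  choose c hc using fun n => (iteratedFDeriv ℝ n Φ x).exists_apply_prod_eq_sum
  refine ⟨fun n i => (n.factorial : ℝ)⁻¹ * c n i, h.congr_left fun v => ?_⟩
  congr 1
  refine Finset.sum_congr rfl fun n _ => ?_
  rw [show (fun _ : Fin n => v) = fun _ => (v.1, v.2) from rfl, hc, Finset.mul_sum]
  exact Finset.sum_congr rfl fun i _ => by ring

/-- Composing a symmetric `C⁴` function of two variables with two fourth-order expansions. -/
theorem exists_hasJet_of_symm {Φ : ℝ × ℝ → ℝ} (hΦ : ContDiffAt ℝ 4 Φ (1, 1))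
    (hsymm : ∀ x y, 0 < x → 0 < y → Φ (y, x) = Φ (x, y)) :
    ∃ c₀ c₁ c₂₀ c₁₁ c₃₀ c₂₁ c₄₀ c₃₁ c₂₂ : ℝ, ∀ (h k : ℝ → ℝ) (h₁ h₂ h₃ h₄ k₁ k₂ k₃ k₄ : ℝ),
      HasJet h 1 h₁ h₂ h₃ h₄ → HasJet k 1 k₁ k₂ k₃ k₄ →
      HasJet (fun t => Φ (h t, k t)) c₀ (c₁ * (h₁ + k₁))
        (c₁ * (h₂ + k₂) + c₂₀ * (h₁ ^ 2 + k₁ ^ 2) + c₁₁ * (h₁ * k₁))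
        (c₁ * (h₃ + k₃) + c₂₀ * (2 * h₁ * h₂ + 2 * k₁ * k₂) + c₁₁ * (h₁ * k₂ + h₂ * k₁) +
          c₃₀ * (h₁ ^ 3 + k₁ ^ 3) + c₂₁ * (h₁ ^ 2 * k₁ + h₁ * k₁ ^ 2))
        (c₁ * (h₄ + k₄) + c₂₀ * (h₂ ^ 2 + 2 * h₁ * h₃ + k₂ ^ 2 + 2 * k₁ * k₃) +
          c₁₁ * (h₁ * k₃ + h₂ * k₂ + h₃ * k₁) + c₃₀ * (3 * h₁ ^ 2 * h₂ + 3 * k₁ ^ 2 * k₂) +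
          c₂₁ * (2 * h₁ * h₂ * k₁ + h₁ ^ 2 * k₂ + h₂ * k₁ ^ 2 + 2 * h₁ * k₁ * k₂) +
          c₄₀ * (h₁ ^ 4 + k₁ ^ 4) + c₃₁ * (h₁ ^ 3 * k₁ + h₁ * k₁ ^ 3) +
          c₂₂ * (h₁ ^ 2 * k₁ ^ 2)) := by
  obtain ⟨c, hc⟩ := exists_taylor_prod hΦ
  refine ⟨c 0 0, (c 1 0 + c 1 1) / 2, (c 2 0 + c 2 2) / 2, c 2 1, (c 3 0 + c 3 3) / 2,
    (c 3 1 + c 3 2) / 2, (c 4 0 + c 4 4) / 2, (c 4 1 + c 4 3) / 2, c 4 2, ?_⟩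
  have key : ∀ (h k : ℝ → ℝ) (h₁ h₂ h₃ h₄ k₁ k₂ k₃ k₄ : ℝ),
      HasJet h 0 h₁ h₂ h₃ h₄ → HasJet k 0 k₁ k₂ k₃ k₄ →
      (fun t => Φ (1 + h t, 1 + k t) - ∑ n ∈ Finset.range 5,
        ∑ i ∈ Finset.range (n + 1), c n i * h t ^ i * k t ^ (n - i)) =o[𝓝 0]
          fun t : ℝ => t ^ 4 := by
    intro h k h₁ h₂ h₃ h₄ k₁ k₂ k₃ k₄ hh hk
    have ht : Tendsto (fun t => (h t, k t)) (𝓝 0) (𝓝 (0 : ℝ × ℝ)) :=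
      hh.tendsto.prodMk_nhds hk.tendsto
    have hO : (fun t => (h t, k t)) =O[𝓝 0] fun t => t := hh.isBigO_id.prod_left hk.isBigO_id
    exact (hc.comp_tendsto ht).trans_isBigO (hO.norm_left.pow 4)
  intro h k h₁ h₂ h₃ h₄ k₁ k₂ k₃ k₄ hh hk
  have hh0 := hh.sub_one
  have hk0 := hk.sub_one
  have e1 := key _ _ _ _ _ _ _ _ _ _ hh0 hk0
  have e2 := key _ _ _ _ _ _ _ _ _ _ hk0 hh0
  -- Averaging with the swapped expansion symmetrises the coefficients, so symmetry of the Taylor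
  -- coefficients themselves never has to be proved.
  have e3 := (e1.add e2).const_mul_left (1 / 2)
  have H2 : HasJet (fun t => (h t - 1) * (h t - 1)) 0 0 (h₁ ^ 2) (2 * h₁ * h₂)
      (h₂ ^ 2 + 2 * h₁ * h₃) :=
    (hh0.mul hh0).congr_coeff (by ring) (by ring) (by ring) (by ring) (by ring)
  have K2 : HasJet (fun t => (k t - 1) * (k t - 1)) 0 0 (k₁ ^ 2) (2 * k₁ * k₂)
      (k₂ ^ 2 + 2 * k₁ * k₃) :=
    (hk0.mul hk0).congr_coeff (by ring) (by ring) (by ring) (by ring) (by ring)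
  have HK : HasJet (fun t => (h t - 1) * (k t - 1)) 0 0 (h₁ * k₁) (h₁ * k₂ + h₂ * k₁)
      (h₁ * k₃ + h₂ * k₂ + h₃ * k₁) :=
    (hh0.mul hk0).congr_coeff (by ring) (by ring) (by ring) (by ring) (by ring)
  have p1 := (hh0.add hk0).const_mul ((c 1 0 + c 1 1) / 2)
  have p2 := (H2.add K2).const_mul ((c 2 0 + c 2 2) / 2)
  have p3 := HK.const_mul (c 2 1)
  have p4 := ((H2.mul hh0).add (K2.mul hk0)).const_mul ((c 3 0 + c 3 3) / 2)
  have p5 := ((H2.mul hk0).add (K2.mul hh0)).const_mul ((c 3 1 + c 3 2) / 2)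
  have p6 := ((H2.mul H2).add (K2.mul K2)).const_mul ((c 4 0 + c 4 4) / 2)
  have p7 := ((H2.mul HK).add (K2.mul HK)).const_mul ((c 4 1 + c 4 3) / 2)
  have p8 := (H2.mul K2).const_mul (c 4 2)
  have p := ((HasJet.const (c 0 0)).add p1).add
    ((p2.add p3).add ((p4.add p5).add ((p6.add p7).add p8)))
  refine (HasJet.of_sub ?_ p).congr_coeff (by ring) (by ring) (by ring) (by ring) (by ring)
  refine e3.congr' ?_ EventuallyEq.rfl
  filter_upwards [hh.tendsto.eventually (lt_mem_nhds one_pos),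
    hk.tendsto.eventually (lt_mem_nhds one_pos)] with t h1 h2
  simp only [add_sub_cancel, hsymm _ _ h1 h2]
  simp [Finset.sum_range_succ]
  ring

/-- Taylor's formula for a function of one variable. -/
theorem hasJet_of_contDiffAt {f : ℝ → ℝ} {x : ℝ} (hf : ContDiffAt ℝ 4 f x) :
    HasJet (fun t => f (x + t)) (f x) (iteratedDeriv 1 f x) (iteratedDeriv 2 f x / 2)
      (iteratedDeriv 3 f x / 6) (iteratedDeriv 4 f x / 24) := by
  have h := taylor_isLittleO_norm (n := 3) (f := f) (x := x) (by exact_mod_cast hf)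
  refine (h.trans_isBigO ((Asymptotics.isBigO_refl (fun t : ℝ => t) (𝓝 0)).norm_left.pow 4)).congr_left fun t => ?_
  have e : ∀ k, iteratedFDeriv ℝ k f x (fun _ => t) = t ^ k * iteratedDeriv k f x := by
    intro k
    rw [iteratedFDeriv_apply_eq_iteratedDeriv_mul_prod]
    simp
  simp only [e, Finset.sum_range_succ, Finset.sum_range_zero, Nat.factorial]
  simp
  ring

/-! ### Partial derivatives in the first variable -/

theorem contDiffAt_deriv_fst {E : Type*} [NormedAddCommGroup E] [NormedSpace ℝ E] {G : ℝ × E → ℝ}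
    {p : ℝ × E} {n : ℕ} (hG : ContDiffAt ℝ (n + 1 : ℕ) G p) :
    ContDiffAt ℝ n (fun q : ℝ × E => deriv (fun x => G (x, q.2)) q.1) p := by
  have h1 : ContDiffAt ℝ n (fun q => fderiv ℝ G q (1, 0)) p :=
    (hG.fderiv_right (by norm_cast)).clm_apply contDiffAt_const
  refine h1.congr_of_eventuallyEq ?_
  filter_upwards [hG.eventually (by simp)] with q hq
  have hd : DifferentiableAt ℝ G q := hq.differentiableAt (by simp)
  have hl : HasDerivAt (fun x : ℝ => (x, q.2)) (1, 0) q.1 :=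
    (hasDerivAt_id q.1).prodMk (hasDerivAt_const q.1 q.2)
  exact (hd.hasFDerivAt.comp_hasDerivAt q.1 hl).deriv

theorem contDiffAt_iteratedDeriv_fst {E : Type*} [NormedAddCommGroup E] [NormedSpace ℝ E]
    {G : ℝ × E → ℝ} {p : ℝ × E} (k : ℕ) {n : ℕ} (hG : ContDiffAt ℝ (n + k : ℕ) G p) :
    ContDiffAt ℝ n (fun q : ℝ × E => iteratedDeriv k (fun x => G (x, q.2)) q.1) p := by
  induction k generalizing n with
  | zero => simpa using hG
  | succ k ih =>
    simp only [iteratedDeriv_succ]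
    exact contDiffAt_deriv_fst (G := fun q => iteratedDeriv k (fun x => G (x, q.2)) q.1)
      (ih (by rwa [add_right_comm, add_assoc]))

theorem iteratedDeriv_const_mul_comp_mul (n : ℕ) (f : ℝ → ℝ) (a c x : ℝ) :
    iteratedDeriv n (fun x => a * f (c * x)) x = a * c ^ n * iteratedDeriv n f (c * x) := by
  induction n generalizing x with
  | zero => simp
  | succ n ih =>
    rw [iteratedDeriv_succ, funext ih, deriv_const_mul_field,
      deriv_comp_mul_left c (iteratedDeriv n f), iteratedDeriv_succ, smul_eq_mul, pow_succ]
    ring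

/-- Euler's relation for the third derivative of a symmetric homogeneous function. -/
theorem partialXXXY_eq {M : ℝ → ℝ → ℝ → ℝ} (hs : IsSymmetric3 M) (hh : IsHomogeneous3 M)
    (hM : ContDiffAt ℝ 4 (onTriples M) (1, 1, 1)) :
    partialXXXY M = -(iteratedDeriv 3 (fun x => M x 1 1) 1 +
      iteratedDeriv 4 (fun x => M x 1 1) 1 / 2) := by
  set K : ℝ × ℝ × ℝ → ℝ := fun p => iteratedDeriv 3 (fun x => M x p.2.1 p.2.2) p.1 with hK
  have hKd : DifferentiableAt ℝ K (1, 1, 1) :=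
    (contDiffAt_iteratedDeriv_fst (G := onTriples M) 3 (n := 1)
      (by exact_mod_cast hM)).differentiableAt (by simp)
  have hf := hKd.hasFDerivAt
  have hx : iteratedDeriv 4 (fun x => M x 1 1) 1 = fderiv ℝ K (1, 1, 1) (1, 0, 0) := by
    rw [iteratedDeriv_succ]
    exact (hf.comp_hasDerivAt (1 : ℝ) (f := fun x : ℝ => ((x, 1, 1) : ℝ × ℝ × ℝ))
      ((hasDerivAt_id 1).prodMk (hasDerivAt_const _ _))).deriv
  have hy : HasDerivAt (fun y => K (1, y, 1)) (fderiv ℝ K (1, 1, 1) (0, 1, 0)) 1 :=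
    hf.comp_hasDerivAt (1 : ℝ) (f := fun y : ℝ => ((1, y, 1) : ℝ × ℝ × ℝ))
      ((hasDerivAt_const _ _).prodMk ((hasDerivAt_id 1).prodMk (hasDerivAt_const _ _)))
  have hz : HasDerivAt (fun z => K (1, 1, z)) (fderiv ℝ K (1, 1, 1) (0, 0, 1)) 1 :=
    hf.comp_hasDerivAt (1 : ℝ) (f := fun z : ℝ => ((1, 1, z) : ℝ × ℝ × ℝ))
      ((hasDerivAt_const _ _).prodMk ((hasDerivAt_const _ _).prodMk (hasDerivAt_id 1)))
  have hyz : (fun y => K (1, y, 1)) =ᶠ[𝓝 1] fun z => K (1, 1, z) := by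
    filter_upwards [lt_mem_nhds one_pos] with y hy0
    refine Filter.EventuallyEq.iteratedDeriv_eq 3 ?_
    filter_upwards [lt_mem_nhds one_pos] with x hx0
    exact (hs x 1 y hx0 one_pos hy0).2
  have hyz' : fderiv ℝ K (1, 1, 1) (0, 1, 0) = fderiv ℝ K (1, 1, 1) (0, 0, 1) :=
    hy.unique (hz.congr_of_eventuallyEq hyz)
  -- `K` is homogeneous of degree `-2`; differentiating along the diagonal says that its three
  -- partial derivatives at `(1, 1, 1)` sum to `-2 * K (1, 1, 1)`. The last two agree by symmetry.
  have hdiag : HasDerivAt (fun s => K (s, s, s)) (fderiv ℝ K (1, 1, 1) (1, 1, 1)) 1 :=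
    hf.comp_hasDerivAt (1 : ℝ) (f := fun s : ℝ => ((s, s, s) : ℝ × ℝ × ℝ))
      ((hasDerivAt_id 1).prodMk ((hasDerivAt_id 1).prodMk (hasDerivAt_id 1)))
  have hdiag' : (fun s => K (s, s, s)) =ᶠ[𝓝 1]
      fun s => (s ^ 2)⁻¹ * iteratedDeriv 3 (fun x => M x 1 1) 1 := by
    filter_upwards [lt_mem_nhds one_pos] with s hs0
    have h1 : (fun x => M x s s) =ᶠ[𝓝 s] fun x => s * (fun x => M x 1 1) (s⁻¹ * x) := by
      filter_upwards [lt_mem_nhds hs0] with x hx0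
      have := hh s (s⁻¹ * x) 1 1 hs0 (by positivity) one_pos one_pos
      rw [mul_inv_cancel_left₀ hs0.ne', mul_one] at this
      exact this
    change iteratedDeriv 3 (fun x => M x s s) s = _
    rw [h1.iteratedDeriv_eq 3]
    refine (iteratedDeriv_const_mul_comp_mul 3 (fun x => M x 1 1) s s⁻¹ s).trans ?_
    rw [inv_mul_cancel₀ hs0.ne']
    field_simp
  have hd2 : HasDerivAt (fun s : ℝ => (s ^ 2)⁻¹ * iteratedDeriv 3 (fun x => M x 1 1) 1)
      (-2 * iteratedDeriv 3 (fun x => M x 1 1) 1) 1 := by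
    have := (((hasDerivAt_pow 2 (1 : ℝ)).inv (by norm_num)).mul_const
      (iteratedDeriv 3 (fun x => M x 1 1) 1))
    exact this.congr_deriv (by norm_num)
  have hE := hdiag.unique (hd2.congr_of_eventuallyEq hdiag')
  have hsplit : ((1, 1, 1) : ℝ × ℝ × ℝ) = (1, 0, 0) + (0, 1, 0) + (0, 0, 1) := by simp
  rw [hsplit, map_add, map_add, ← hsplit, ← hx, ← hyz'] at hE
  have hfin : partialXXXY M = fderiv ℝ K (1, 1, 1) (0, 1, 0) := hy.deriv
  rw [hfin]
  linarith

/-! ### The fourth-order expansions of invariant means -/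

theorem HasJet.comp_one {f g : ℝ → ℝ} {a₀ a₁ a₂ a₃ a₄ b₁ b₂ b₃ b₄ : ℝ}
    (hf : HasJet (fun t => f (1 + t)) a₀ a₁ a₂ a₃ a₄) (hg : HasJet g 1 b₁ b₂ b₃ b₄) :
    HasJet (fun t => f (g t)) a₀ (a₁ * b₁) (a₁ * b₂ + a₂ * b₁ ^ 2)
      (a₁ * b₃ + 2 * a₂ * b₁ * b₂ + a₃ * b₁ ^ 3)
      (a₁ * b₄ + a₂ * (b₂ ^ 2 + 2 * b₁ * b₃) + 3 * a₃ * b₁ ^ 2 * b₂ + a₄ * b₁ ^ 4) :=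
  (hf.comp hg.sub_one).congr_fun (Eventually.of_forall fun t => by
    simp only [add_sub_cancel])

theorem hasJet_exp_neg : HasJet (fun t => (Real.exp t)⁻¹) 1 (-1) (1 / 2) (-1 / 6) (1 / 24) :=
  hasJet_exp.inv (by norm_num) (by norm_num) (by norm_num) (by norm_num) (by norm_num)

theorem hasJet_inv_dslope_exp :
    HasJet (fun t => (dslope Real.exp 0 t)⁻¹) 1 (-1 / 2) (1 / 12) 0 (-1 / 720) :=
  hasJet_dslope_exp.inv (by norm_num) (by norm_num) (by norm_num) (by norm_num) (by norm_num)

theorem logMean_exp_one (t : ℝ) : logMean (Real.exp t) 1 = dslope Real.exp 0 t := by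
  rw [logMean_comm, logMean_eq_mul_dslope one_pos (Real.exp_pos t)]
  simp

theorem dslope_exp_pos (t : ℝ) : 0 < dslope Real.exp 0 t := by
  rw [← logMean_exp_one]
  exact logMean_pos (Real.exp_pos t) one_pos

section

variable {M : ℝ → ℝ → ℝ → ℝ}

theorem IsMean3.apply_self (hM : IsMean3 M) {a : ℝ} (ha : 0 < a) : M a a a = a := by
  have h := hM.2 a a a ha ha ha
  simp only [min_self, max_self] at h
  exact le_antisymm h.2 h.1

theorem IsSymmetric3.rotate (hs : IsSymmetric3 M) {a b c : ℝ} (ha : 0 < a) (hb : 0 < b)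
    (hc : 0 < c) : M a b c = M c a b := by
  rw [(hs c a b hc ha hb).1.symm, (hs a b c ha hb hc).2]

theorem hasJet_fst (hM : IsMean3 M) (hC : ContDiffAt ℝ 4 (onTriples M) (1, 1, 1)) :
    HasJet (fun t => M (1 + t) 1 1) 1 (iteratedDeriv 1 (fun x => M x 1 1) 1)
      (iteratedDeriv 2 (fun x => M x 1 1) 1 / 2) (iteratedDeriv 3 (fun x => M x 1 1) 1 / 6)
      (iteratedDeriv 4 (fun x => M x 1 1) 1 / 24) := by
  have h : ContDiffAt ℝ 4 (fun x => M x 1 1) 1 :=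
    ContDiffAt.comp (f := fun x : ℝ => ((x, 1, 1) : ℝ × ℝ × ℝ)) (g := onTriples M) 1 hC
      (contDiff_id.prodMk contDiff_const).contDiffAt
  have := hasJet_of_contDiffAt h
  rwa [hM.apply_self one_pos] at this

/-- The derivatives at `1` of `x ↦ M x 1 1`, for a type 1 invariant mean. -/
theorem coeffs_of_type1Invariant (hs : IsSymmetric3 M) (hh : IsHomogeneous3 M)
    (h1 : Type1Invariant M logMean) {μ₁ μ₂ μ₃ μ₄ : ℝ}
    (hm : HasJet (fun t => M (1 + t) 1 1) 1 μ₁ μ₂ μ₃ μ₄) :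
    μ₃ = 28 / 729 ∧ μ₄ = -452 / 18225 := by
  -- Invariance at `(exp t, 1, 1)` yields the triple `(δ, δ, 1)` up to order, where `δ = logMean
  -- (exp t) 1`. Scaling by `δ⁻¹` leaves again only one argument different from `1`.
  have heq : ∀ t, M (Real.exp t) 1 1 =
      dslope Real.exp 0 t * M (dslope Real.exp 0 t)⁻¹ 1 1 := by
    intro t
    have hδ := dslope_exp_pos t
    have hi := inv_pos.2 hδ
    have e1 := h1 (Real.exp t) 1 1 (Real.exp_pos t) one_pos one_pos
    rw [logMean_exp_one, logMean_self] at e1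
    have e2 := hh (dslope Real.exp 0 t) 1 1 (dslope Real.exp 0 t)⁻¹ hδ one_pos one_pos hi
    rw [mul_one, mul_inv_cancel₀ hδ.ne', e1, hs.rotate one_pos one_pos hi] at e2
    exact e2
  have hl := HasJet.comp_one (f := fun x => M x 1 1) hm hasJet_exp
  have hr := hasJet_dslope_exp.mul (HasJet.comp_one (f := fun x => M x 1 1) hm hasJet_inv_dslope_exp)
  -- At order `k`, the unknown `μ_k` has coefficient `1` on the left and `(-1 / 2) ^ k` on the
  -- right, so the system is triangular and solvable.
  obtain ⟨-, q1, q2, q3, q4⟩ := (hl.congr_fun (Eventually.of_forall heq)).unique hr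
  have m1 : μ₁ = 1 / 3 := by linarith
  subst m1
  have m2 : μ₂ = -2 / 27 := by linarith
  subst m2
  have m3 : μ₃ = 28 / 729 := by linarith
  subst m3
  exact ⟨rfl, by linarith⟩

/-- The fourth derivative at `1` of `x ↦ M x 1 1`, for a type 2 invariant mean with the third
derivative of the invariant logarithmic mean. -/
theorem coeff_of_type2Invariant (hs : IsSymmetric3 M) (hh : IsHomogeneous3 M)
    (hC : ContDiffAt ℝ 4 (onTriples M) (1, 1, 1)) (h2 : Type2Invariant M logMean)
    {μ₁ μ₂ μ₃ μ₄ : ℝ} (hm : HasJet (fun t => M (1 + t) 1 1) 1 μ₁ μ₂ μ₃ μ₄)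
    (h3 : μ₃ = 28 / 729) : μ₄ = -272 / 10935 := by
  have hΦ : ContDiffAt ℝ 4 (fun p : ℝ × ℝ => M p.1 p.2 1) (1, 1) :=
    ContDiffAt.comp (f := fun p : ℝ × ℝ => ((p.1, p.2, 1) : ℝ × ℝ × ℝ)) (g := onTriples M) (1, 1)
      hC (contDiff_fst.prodMk (contDiff_snd.prodMk contDiff_const)).contDiffAt
  obtain ⟨c₀, c₁, c₂₀, c₁₁, c₃₀, c₂₁, c₄₀, c₃₁, c₂₂, hc⟩ :=
    exists_hasJet_of_symm hΦ fun x y hx hy => (hs x y 1 hx hy one_pos).1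
  have hone := hc _ _ _ _ _ _ _ _ _ _ (HasJet.poly 1 1 0 0 0) (HasJet.const 1)
  have hone' := hone.congr_fun (g := fun t => M (1 + t) 1 1)
    (Eventually.of_forall fun t => by simp)
  obtain ⟨-, a1, a2, a3, a4⟩ := hm.unique hone'
  have hee := hc _ _ _ _ _ _ _ _ _ _ hasJet_exp hasJet_exp
  -- With only `M x y 1` expanded, homogeneity and symmetry in the third argument survive as
  -- functional equations. This one and `hde'` give two relations between the three fourth-order
  -- coefficients.
  have hee' : ∀ t, M (Real.exp t) (Real.exp t) 1 = Real.exp t * M (Real.exp t)⁻¹ 1 1 := by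
    intro t
    have hp := Real.exp_pos t
    have := hh (Real.exp t) 1 1 (Real.exp t)⁻¹ hp one_pos one_pos (inv_pos.2 hp)
    rwa [mul_one, mul_inv_cancel₀ hp.ne', hs.rotate one_pos one_pos (inv_pos.2 hp)] at this
  obtain ⟨b0, b1, b2, b3, b4⟩ := (hee.congr_fun (Eventually.of_forall hee')).unique
    (hasJet_exp.mul (HasJet.comp_one (f := fun x => M x 1 1) hm hasJet_exp_neg))
  have he2 : HasJet (fun t => Real.exp t * Real.exp t) 1 2 2 (4 / 3) (2 / 3) :=
    (hasJet_exp.mul hasJet_exp).congr_coeff (by norm_num) (by norm_num) (by norm_num)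
      (by norm_num) (by norm_num)
  have hde := hc _ _ _ _ _ _ _ _ _ _ he2 hasJet_exp
  have hde' : ∀ t, M (Real.exp t * Real.exp t) (Real.exp t) 1 =
      Real.exp t * M (Real.exp t) (Real.exp t)⁻¹ 1 := by
    intro t
    have hp := Real.exp_pos t
    have hi := inv_pos.2 hp
    have := hh (Real.exp t) (Real.exp t) 1 (Real.exp t)⁻¹ hp hp one_pos hi
    rwa [mul_one, mul_inv_cancel₀ hp.ne', (hs _ _ _ hp hi one_pos).2] at this
  obtain ⟨-, d1, d2, d3, d4⟩ := (hde.congr_fun (Eventually.of_forall hde')).unique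
    (hasJet_exp.mul (hc _ _ _ _ _ _ _ _ _ _ hasJet_exp hasJet_exp_neg))
  have hβ : HasJet (fun t => Real.exp t * (dslope Real.exp 0 t)⁻¹) 1 (1 / 2) (1 / 12) 0 (-1 / 720) :=
    (hasJet_exp.mul hasJet_inv_dslope_exp).congr_coeff (by norm_num) (by norm_num) (by norm_num)
      (by norm_num) (by norm_num)
  have hββ := hc _ _ _ _ _ _ _ _ _ _ hβ hasJet_inv_dslope_exp
  -- Type 2 invariance at `(exp t, 1)`, scaled so that the third argument is `1`. The two linear
  -- coefficients are `1 / 2` and `-1 / 2`, so `c₃₀` and `c₂₁` drop out at order three; this is why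
  -- `μ₃` has to be given.
  have hββ' : ∀ t, M (Real.exp t * (dslope Real.exp 0 t)⁻¹) (dslope Real.exp 0 t)⁻¹ 1 = 1 := by
    intro t
    have hp := Real.exp_pos t
    have hδ := dslope_exp_pos t
    have hi := inv_pos.2 hδ
    have e1 := h2 (Real.exp t) 1 hp one_pos
    rw [logMean_exp_one] at e1
    have e2 := hh (dslope Real.exp 0 t)⁻¹ (Real.exp t) 1 (dslope Real.exp 0 t) hi hp one_pos hδ
    rwa [e1, inv_mul_cancel₀ hδ.ne', mul_one, mul_comm] at e2
  obtain ⟨-, f1, f2, f3, f4⟩ := (hββ.congr_fun (Eventually.of_forall hββ')).unique (HasJet.const 1)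
  -- The order-four relations from `hee'`, `hde'` and `hββ'` are independent linear equations for
  -- `c₄₀`, `c₃₁`, `c₂₂`, and `μ₄` equals `c₄₀`.
  linarith

end

/-- The derivatives at `1` of `x ↦ logMean3 x 1 1`. -/
theorem iteratedDeriv_logMean3 :
    iteratedDeriv 3 (fun x => logMean3 x 1 1) 1 = 56 / 243 ∧
      iteratedDeriv 4 (fun x => logMean3 x 1 1) 1 = -3616 / 6075 := by
  obtain ⟨h3, h4⟩ := coeffs_of_type1Invariant isSymmetric3_logMean3
    isHomogeneous3_logMean3 type1Invariant_logMean3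
    (hasJet_fst isMean3_logMean3 contDiffAt_onTriples_logMean3)
  constructor <;> linarith

/-! ### The two values of the mixed derivative and their incompatibility -/

theorem partialXXXY_logMean3 : partialXXXY logMean3 = 136 / 2025 := by
  rw [partialXXXY_eq isSymmetric3_logMean3 isHomogeneous3_logMean3 contDiffAt_onTriples_logMean3,
    iteratedDeriv_logMean3.1, iteratedDeriv_logMean3.2]
  norm_num

theorem partialXXXY_of_type2Invariant {M : ℝ → ℝ → ℝ → ℝ} (hM : IsMean3 M) (hs : IsSymmetric3 M)
    (hh : IsHomogeneous3 M) (hC : ContDiffAt ℝ 4 (onTriples M) (1, 1, 1))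
    (h2 : Type2Invariant M logMean) (h3 : partialXXX M = partialXXX logMean3) :
    partialXXXY M = 248 / 3645 := by
  have e3 : iteratedDeriv 3 (fun x => M x 1 1) 1 = 56 / 243 := h3.trans iteratedDeriv_logMean3.1
  have e4 := coeff_of_type2Invariant hs hh hC h2 (hasJet_fst hM hC) (by rw [e3]; norm_num)
  rw [partialXXXY_eq hs hh hC, e3]
  linarith

theorem not_type2Invariant_logMean3 : ¬ Type2Invariant logMean3 logMean := by
  intro h
  have h1 := partialXXXY_of_type2Invariant isMean3_logMean3 isSymmetric3_logMean3
    isHomogeneous3_logMean3 contDiffAt_onTriples_logMean3 h rfl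
  rw [partialXXXY_logMean3] at h1
  norm_num at h1

theorem mainTheorem12 :
    -- `L₃` is the invariant logarithmic mean: the unique mean in three variables that is
    -- type 1 invariant with respect to `L`; moreover it is symmetric
    (IsMean3 logMean3 ∧ IsSymmetric3 logMean3 ∧ Type1Invariant logMean3 logMean ∧
      ∀ M : ℝ → ℝ → ℝ → ℝ, IsMean3 M → Type1Invariant M logMean →
        ∀ a b c : ℝ, 0 < a → 0 < b → 0 < c → M a b c = logMean3 a b c) ∧
    -- it is not type 2 invariant with respect to `L`
    ¬ Type2Invariant logMean3 logMean ∧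
    -- its fourth-order partial derivative exists and has the stated value
    (ContDiffAt ℝ 4 (onTriples logMean3) (1, 1, 1) ∧ partialXXXY logMean3 = 136 / 2025) ∧
    -- the value that both invariances together would force
    (∀ M : ℝ → ℝ → ℝ → ℝ, IsMean3 M → IsSymmetric3 M →
      Type1Invariant M logMean → Type2Invariant M logMean → partialXXXY M = 248 / 3645) ∧
    -- the same value from type 2 invariance and only the third-order consequence of type 1
    -- invariance (so that the hypotheses do not contradict each other)
    (∀ M : ℝ → ℝ → ℝ → ℝ, IsMean3 M → IsSymmetric3 M → IsHomogeneous3 M →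
      ContDiffAt ℝ 4 (onTriples M) (1, 1, 1) →
      Type2Invariant M logMean → partialXXX M = partialXXX logMean3 →
        partialXXXY M = 248 / 3645) := by
  refine ⟨⟨isMean3_logMean3, isSymmetric3_logMean3, type1Invariant_logMean3,
    fun M hM h1 a b c ha hb hc => eq_logMean3_of_type1Invariant hM h1 ha hb hc⟩,
    not_type2Invariant_logMean3, ⟨contDiffAt_onTriples_logMean3, partialXXXY_logMean3⟩,
    fun M hM _ h1 h2 => ?_, fun M hM hs hh hC h2 h3 =>
      partialXXXY_of_type2Invariant hM hs hh hC h2 h3⟩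
  -- By uniqueness such an `M` coincides with `logMean3`, which is not type 2 invariant, so this
  -- clause holds vacuously.
  refine absurd (fun a b ha hb => ?_) not_type2Invariant_logMean3
  rw [← eq_logMean3_of_type1Invariant hM h1 ha hb (logMean_pos ha hb)]
  exact h2 a b ha hb
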